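/- Let $d\in\mathbb N$, $d\ge 1$. Let $\mu$ be a probability measure on $\mathbb R$ with bounded support and with a density $\rho\in\mathrm{BV}(\mathbb R)$, i.e. $\rho\in L^1(\mathbb R)$ and the distributional derivative of $\rho$ is a finite signed Borel measure. Let $\Omega=\prod_{k\in\mathbb Z^d}\operatorname{supp}\mu$ with the product $\sigma$-algebra and $\mathbb P=\bigotimes_{k\in\mathbb Z^d}\mu$. Let $u:\mathbb Z^d\to\mathbb R$, $u\not\equiv 0$, satisfy $|u(k)|\le C\mathrm e^{-\alpha\|k\|_1}$ for all $k\in\mathbb Z^d$ with some constants $C,\alpha>0$. For $\omega\in\Omega$ let $h_\omega=h_0+v_\omega$ on $\ell^2(\mathbb Z^d)$, where $(h_0\psi)(x)=\sum_{\|x-y\|_1=1}(\psi(x)-\psi(y))$ and $v_\omega$ is multiplication by $v_\omega(x)=\sum_{k\in\mathbb Z^d}\omega_k u(x-k)$. For real $l>0$ and $x\in\mathbb Z^d$ let $\mathfrak C_l(x)=([-l,l]^d+x)\cap\mathbb Z^d$, and let $h_\omega^{\mathfrak C_l(x)}$ be the compression of $h_\omega$ to $\ell^2(\mathfrak C_l(x))$.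 For $m>0$ and $E\in\mathbb R$ the cube $\mathfrak C_l(x)$ is called $(m,E)$-regular for $\omega$ if $E\notin\sigma(h_\omega^{\mathfrak C_l(x)})$ and $|\langle\delta_x,(h_\omega^{\mathfrak C_l(x)}-E)^{-1}\delta_w\rangle|\le \mathrm e^{-ml}$ for all $w$ in the interior boundary of $\mathfrak C_l(x)$, i.e. for all $w\in\mathfrak C_l(x)$ having fewer than $2d$ nearest neighbours in $\mathfrak C_l(x)$. It is called uniformly $(m,E)$-regular for $\omega$ if it is $(m,E)$-regular for every $\omega'\in\Omega$ with $\omega'_k=\omega_k$ for all $k\in\mathfrak C_{4l}(x)$. For an interval $I\subset\mathbb R$ let \[B_l(z_1,z_2,m,I)=\{\omega\in\Omega:\ \exists E\in I:\ \mathfrak C_l(z_1)\text{ and }\mathfrak C_l(z_2)\text{ are both not uniformly }(m,E)\text{-regular}\}.\] For $\xi>0$ we say that $G(I,l,m,\xi)$ is satisfied if $\mathbb P(B_l(z_1,z_2,m,I)^{\mathrm c})\ge 1-l^{-2\xi}$ for all $z_1,z_2\in\mathbb Z^d$ with $\|z_1-z_2\|_\infty>8l$. **Theorem.** Fix $\xi>2d$,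 $\kappa\in(1,2\xi/(\xi+2d))$ and $\beta\in(2-\kappa,1)$. Then there is $l^*=l^*(d,\xi,\kappa,\beta,u,\rho)\ge 1$ such that for every interval $I\subset\mathbb R$, every real $l\ge l^*$ and every $m>l^{\beta-1}$: if $G(I,l,m,\xi)$ is satisfied, then with $L=l^\kappa$ there is $m_L>0$ such that $G(I,L,m_L,\xi)$ is satisfied and \[m>m_L>m\bigl(1-L^{-(1-\beta)/\kappa}\bigr)-L^{-(1-\beta)/\kappa}\qquad\text{and}\qquad m_L>L^{\beta-1}.\] -/

import Mathlib

open MeasureTheory Set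

noncomputable section

namespace AlloyMSA

/-- The lattice `ℤ^d`. Mathlib's norm on this type is the supremum norm. -/
abbrev Site (d : ℕ) : Type := Fin d → ℤ

/-- The `ℓ¹`-norm on `ℤ^d`. -/
def norm1 {d : ℕ} (k : Site d) : ℤ := ∑ i, |k i|

/-- The discrete cube `([-l,l]^d + j) ∩ ℤ^d`, for real `l`. -/
def cube {d : ℕ} (l : ℝ) (j : Site d) : Finset (Site d) :=
  Fintype.piFinset fun i => Finset.Icc ⌈(j i : ℝ) - l⌉ ⌊(j i : ℝ) + l⌋

theorem mem_cube {d : ℕ} {l : ℝ} {j k : Site d} :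
    k ∈ cube l j ↔ ∀ i, |(k i : ℝ) - (j i : ℝ)| ≤ l := by
  simp only [cube, Fintype.mem_piFinset, Finset.mem_Icc, Int.ceil_le, Int.le_floor, abs_le]
  refine forall_congr' fun i => ⟨fun h => ⟨by linarith [h.1], by linarith [h.2]⟩,
    fun h => ⟨by linarith [h.1], by linarith [h.2]⟩⟩

/-- The nearest neighbours of `x`, i.e. all `y ∈ ℤ^d` with `‖x - y‖₁ = 1`. -/
def neighbors {d : ℕ} (x : Site d) : Finset (Site d) :=
  (cube 1 x).filter fun y => norm1 (x - y) = 1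

theorem mem_neighbors {d : ℕ} {x y : Site d} : y ∈ neighbors x ↔ norm1 (x - y) = 1 := by
  simp only [neighbors, Finset.mem_filter, and_iff_right_iff_imp]
  intro h
  rw [mem_cube]
  intro i
  have h1 : |(x - y) i| ≤ norm1 (x - y) :=
    Finset.single_le_sum (f := fun i => |(x - y) i|) (fun _ _ => abs_nonneg _) (Finset.mem_univ i)
  rw [h, Pi.sub_apply, abs_sub_comm] at h1
  exact_mod_cast h1

/-- The interior boundary of `S ⊆ ℤ^d`: the points of `S` having fewer than `2d` nearest
neighbours in `S`. -/
def innerBoundary {d : ℕ} (S : Finset (Site d)) : Finset (Site d) :=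
  S.filter fun k => (S.filter fun j => norm1 (k - j) = 1).card < 2 * d

/-- Exponential decay of the single-site potential. -/
def ExpDecay {d : ℕ} (u : Site d → ℝ) : Prop :=
  ∃ C α : ℝ, 0 < C ∧ 0 < α ∧ ∀ k, |u k| ≤ C * Real.exp (-α * (norm1 k : ℝ))

/-- `BV(ℝ)`: integrable functions whose distributional derivative is a finite signed
measure `ν`, which is integrated through its Jordan decomposition. -/
def IsBV (f : ℝ → ℝ) : Prop :=
  Integrable f volume ∧ ∃ ν : SignedMeasure ℝ, ∀ φ : ℝ → ℝ,
    ContDiff ℝ ((⊤ : ℕ∞) : WithTop ℕ∞) φ → HasCompactSupport φ →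
    (∫ x, φ x ∂ν.toJordanDecomposition.posPart) - (∫ x, φ x ∂ν.toJordanDecomposition.negPart)
      = -∫ x, f x * deriv φ x

/-- `ρ` is a density of `μ` with respect to Lebesgue measure. -/
def IsDensity (μ : Measure ℝ) (ρ : ℝ → ℝ) : Prop :=
  (∀ᵐ t ∂(volume : Measure ℝ), 0 ≤ ρ t) ∧ μ = volume.withDensity fun t => ENNReal.ofReal (ρ t)

/-- The configuration space `Ω = ∏_{k ∈ ℤ^d} supp μ`. -/
abbrev Config (d : ℕ) (μ : Measure ℝ) : Type := Site d → μ.support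

/-- `μ` regarded as a measure on its support. -/
def siteMeasure (μ : Measure ℝ) : Measure μ.support := μ.comap Subtype.val

instance (μ : Measure ℝ) [IsProbabilityMeasure μ] : IsProbabilityMeasure (siteMeasure μ) := by
  refine (MeasurableEmbedding.subtype_coe
    Measure.isClosed_support.measurableSet).isProbabilityMeasure_comap ?_
  rw [Subtype.range_coe]
  exact Measure.support_mem_ae

/-- The product measure `ℙ = ⨂_{k ∈ ℤ^d} μ` on `Ω`. -/
def prob (d : ℕ) (μ : Measure ℝ) : Measure (Config d μ) :=
  Measure.infinitePi fun _ => siteMeasure μ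

instance (d : ℕ) (μ : Measure ℝ) [IsProbabilityMeasure μ] : IsProbabilityMeasure (prob d μ) := by
  unfold prob; infer_instance

variable {d : ℕ} {μ : Measure ℝ}

/-- The alloy-type potential `v_ω(x) = ∑_k ω_k u(x - k)`. -/
def potential (u : Site d → ℝ) (ω : Config d μ) (x : Site d) : ℝ :=
  ∑' k, (ω k : ℝ) * u (x - k)

/-- The action of `h_ω = h_0 + v_ω` on functions on `ℤ^d`, with
`(h_0 ψ)(x) = ∑_{‖x-y‖₁ = 1} (ψ(x) - ψ(y))`. -/
def hamiltonian (u : Site d → ℝ) (ω : Config d μ) (ψ : Site d → ℝ) (x : Site d) : ℝ :=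
  (∑ y ∈ neighbors x, (ψ x - ψ y)) + potential u ω x * ψ x

/-- The matrix of the restriction of `h_ω` to `ℓ²(S)`: its entries are `(h_ω δ_y)(x)`,
`x, y ∈ S`. -/
def boxHamiltonian (u : Site d → ℝ) (ω : Config d μ) (S : Finset (Site d)) : Matrix S S ℝ :=
  Matrix.of fun x y => hamiltonian u ω (Pi.single (y : Site d) 1) x

/-- The Green's function `⟨δ_x, (h_ω^S - E)⁻¹ δ_y⟩`, set to zero if `x ∉ S` or `y ∉ S`. -/
def green (u : Site d → ℝ) (ω : Config d μ) (S : Finset (Site d)) (E : ℝ) (x y : Site d) : ℝ :=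
  if h : x ∈ S ∧ y ∈ S then
    (boxHamiltonian u ω S - E • (1 : Matrix S S ℝ))⁻¹ ⟨x, h.1⟩ ⟨y, h.2⟩
  else 0

/-- The cube of radius `l` about `x` is `(m,E)`-regular for `ω`. -/
def IsRegular (u : Site d → ℝ) (l : ℝ) (x : Site d) (m E : ℝ) (ω : Config d μ) : Prop :=
  E ∉ spectrum ℝ (boxHamiltonian u ω (cube l x)) ∧
    ∀ w ∈ innerBoundary (cube l x), |green u ω (cube l x) E x w| ≤ Real.exp (-(m * l))

/-- The cube of radius `l` about `x` is uniformly `(m,E)`-regular for `ω`: it is `(m,E)`-regular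
for all configurations that agree with `ω` on the cube of radius `4l` about `x`. -/
def IsUnifRegular (u : Site d → ℝ) (l : ℝ) (x : Site d) (m E : ℝ) (ω : Config d μ) : Prop :=
  ∀ ω' : Config d μ, (∀ k ∈ cube (4 * l) x, ω' k = ω k) → IsRegular u l x m E ω'

/-- The event that for some `E ∈ I` neither of the cubes of radius `l` about `z₁` and `z₂` is
uniformly `(m,E)`-regular. -/
def badEvent (μ : Measure ℝ) (u : Site d → ℝ) (l : ℝ) (z₁ z₂ : Site d) (m : ℝ) (I : Set ℝ) :
    Set (Config d μ) :=
  {ω | ∃ E ∈ I, ¬ IsUnifRegular u l z₁ m E ω ∧ ¬ IsUnifRegular u l z₂ m E ω}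

/-- The estimate `G(I,l,m,ξ)`. -/
def GEstimate (μ : Measure ℝ) (u : Site d → ℝ) (I : Set ℝ) (l m ξ : ℝ) : Prop :=
  ∀ z₁ z₂ : Site d, 8 * l < ‖z₁ - z₂‖ →
    1 - l ^ (-(2 * ξ)) ≤ (prob d μ).real (badEvent μ u l z₁ z₂ m I)ᶜ

end AlloyMSA

end

/-! Deterministic part. Suppose that no concentric subcube of the L-cube about x is resonant at E
(approximate null vector with relative error ε, so that non-resonance bounds the resolvent by 1/ε)
and that the centres of non-regular l-cubes in it lie in three balls of radius 8l. Applying the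
geometric resolvent identity to the subcube of radius r, and then to the regular l-cubes centred
just outside it, bounds the Green's function on radius r by γ times its bound on radius r + s, where
s is about l and γ is exp(-ml)/ε times a power of L. The three balls spoil only O(l) radii, so about
L/l contractions remain and the rate m drops by no more than the theorem allows
(`isRegular_of_regular_subcubes`, `exists_step_count`). The width is ε = exp(-l^(β/2)).

Probabilistic part. Two L-cubes can both fail only in two ways (`badEvent_subset`). Either one of
them contains four distant bad l-cubes. Uniform regularity depends on the couplings in a cube of
radius 4l only, so two pairs of these are exactly independent although u has infinite range; this
gives a probability of order L^(4d) l^(-4ξ), which the upper bound on κ makes smaller than L^(-2ξ)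
(`measure_fourBadEvent_le`). Or both contain concentric subcubes resonant at one common energy,
which a Wegner-type estimate bounds by √ε times a power of L (`exists_uniform_wegner`).

Wegner estimate. Since u may change sign, the potential need not be monotone in any coupling.
However, the lowest non-vanishing moment of u along an injective linear form ℓ shows that the
weights ℓ(k)^n convolve with u to a non-zero constant (`exists_direction`). Moving the couplings in
this direction raises the potential on the whole cube. By a min-max count, a fixed energy is then
resonant for at most as many steps as the cube has points (`card_resonant_le`), while the BV density
makes each translation cheap in probability (`ShiftBound.pi`). Averaging over the translates gives
the estimate (`ShiftBound.measure_le_of_card`). -/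

/-! ### Shifts of measures with a density of bounded variation -/

namespace AlloyMSA

/-- Translating a probability measure by `s` changes the measure of any set by at most `V * |s|`. -/
def ShiftBound (μ : Measure ℝ) (V : ℝ) : Prop :=
  ∀ (s : ℝ) (B : Set ℝ), MeasurableSet B →
    μ B ≤ μ ((fun t => t + s) ⁻¹' B) + ENNReal.ofReal (V * |s|)

theorem integral_density {μ : Measure ℝ} {ρ : ℝ → ℝ} (hρ : IsDensity μ ρ)
    (hint : Integrable ρ volume) (φ : ℝ → ℝ) : ∫ t, φ t ∂μ = ∫ t, ρ t * φ t := by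
  rw [hρ.2, integral_withDensity_eq_integral_toReal_smul₀]
  · refine integral_congr_ae ?_
    filter_upwards [hρ.1] with t ht
    simp [ENNReal.toReal_ofReal ht]
  · exact hint.1.aemeasurable.ennreal_ofReal
  · exact Filter.Eventually.of_forall fun t => ENNReal.ofReal_lt_top

/-- φ(t + s) - φ(t) is the derivative of ψ(t) = ∫ φ over [t, t + s], which has compact support and
satisfies |ψ| ≤ |s|. Testing the derivative ν of ρ against ψ costs at most |s| times the total
variation of ν, and this is V. -/
theorem exists_integral_sub_shift_le {μ : Measure ℝ} [IsProbabilityMeasure μ] {ρ : ℝ → ℝ}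
    (hρ : IsDensity μ ρ) (hBV : IsBV ρ) :
    ∃ V : ℝ, 0 ≤ V ∧ ∀ (s : ℝ) (φ : ℝ → ℝ), ContDiff ℝ ((⊤ : ℕ∞) : WithTop ℕ∞) φ →
      HasCompactSupport φ → (∀ t, |φ t| ≤ 1) →
      (∫ t, φ t ∂μ) ≤ (∫ t, φ (t + s) ∂μ) + V * |s| := by
  obtain ⟨hint, ν, hν⟩ := hBV
  set p := ν.toJordanDecomposition.posPart
  set q := ν.toJordanDecomposition.negPart
  refine ⟨p.real univ + q.real univ, by positivity, fun s φ hφ hc h1 => ?_⟩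
  have hφc : Continuous φ := hφ.continuous
  let Φ : ℝ → ℝ := fun t => ∫ r in (0 : ℝ)..t, φ r
  have hΦd : ∀ t, HasDerivAt Φ (φ t) t := fun t =>
    intervalIntegral.integral_hasDerivAt_right (hφc.intervalIntegrable _ _)
      (hφc.stronglyMeasurableAtFilter _ _) hφc.continuousAt
  have hΦ : ContDiff ℝ ((⊤ : ℕ∞) : WithTop ℕ∞) Φ := by
    refine contDiff_infty_iff_deriv.2 ⟨fun t => (hΦd t).differentiableAt, ?_⟩
    have : deriv Φ = φ := funext fun t => (hΦd t).deriv
    rwa [this]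
  let ψ : ℝ → ℝ := fun t => Φ (t + s) - Φ t
  have hψI : ∀ t, ψ t = ∫ r in t..(t + s), φ r := fun t =>
    intervalIntegral.integral_interval_sub_left (hφc.intervalIntegrable _ _)
      (hφc.intervalIntegrable _ _)
  have hψ : ContDiff ℝ ((⊤ : ℕ∞) : WithTop ℕ∞) ψ :=
    (hΦ.comp (contDiff_id.add contDiff_const)).sub hΦ
  have hψd : ∀ t, deriv ψ t = φ (t + s) - φ t := fun t =>
    (((hΦd (t + s)).comp_add_const t s).sub (hΦd t)).deriv
  have hψb : ∀ t, |ψ t| ≤ |s| := by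
    intro t
    rw [hψI]
    have := intervalIntegral.norm_integral_le_of_norm_le_const (a := t) (b := t + s) (f := φ)
      (C := 1) (fun x _ => h1 x)
    simpa using this
  obtain ⟨R, hR⟩ := hc.isBounded.subset_closedBall 0
  have hφ0 : ∀ t, R < |t| → φ t = 0 := by
    intro t ht
    by_contra hne
    have := hR (subset_tsupport φ hne)
    simp only [Metric.mem_closedBall, dist_zero_right, Real.norm_eq_abs] at this
    linarith
  have hψc : HasCompactSupport ψ := by
    refine HasCompactSupport.intro (isCompact_Icc (a := -(R + |s|)) (b := R + |s|)) fun t ht => ?_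
    have ht' : R + |s| < |t| := by
      by_contra hcon
      exact ht (abs_le.1 (not_lt.1 hcon))
    rw [hψI]
    refine (intervalIntegral.integral_congr (g := fun _ => (0 : ℝ)) fun r hr => ?_).trans (by simp)
    refine hφ0 r ?_
    have h2 : |r - t| ≤ |s| := by
      have := abs_sub_left_of_mem_uIcc hr
      simpa using this
    have := abs_sub_abs_le_abs_sub t r
    rw [abs_sub_comm] at this
    linarith
  have key := hν ψ hψ hψc
  have hφi : Integrable (fun t => ρ t * φ t) volume := by
    simpa [mul_comm] using hint.bdd_mul (c := 1) hφc.aestronglyMeasurable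
      (Filter.Eventually.of_forall fun t => h1 t)
  have hφsi : Integrable (fun t => ρ t * φ (t + s)) volume := by
    have hcs : Continuous fun t => φ (t + s) := by fun_prop
    have := hint.bdd_mul (c := 1) hcs.aestronglyMeasurable
      (Filter.Eventually.of_forall fun t => h1 (t + s))
    simpa [mul_comm] using this
  have h3 : ∫ x, ρ x * deriv ψ x = (∫ t, φ (t + s) ∂μ) - ∫ t, φ t ∂μ := by
    rw [integral_density hρ hint, integral_density hρ hint, ← integral_sub hφsi hφi]
    simp [hψd, mul_sub]
  have hb : ∀ (m : Measure ℝ) [IsFiniteMeasure m], |∫ x, ψ x ∂m| ≤ |s| * m.real univ := by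
    intro m _
    exact norm_integral_le_of_norm_le_const (f := ψ) (Filter.Eventually.of_forall fun t => hψb t)
  have hp := abs_le.1 (hb p)
  have hq := abs_le.1 (hb q)
  rw [h3] at key
  linarith [hp.1, hp.2, hq.1, hq.2]

/-- Regularity passes from test functions to sets: a compact K in B for μ, an open U around K for
the translated measure, and a smooth bump between them. -/
theorem exists_shiftBound {μ : Measure ℝ} [IsProbabilityMeasure μ] {ρ : ℝ → ℝ}
    (hρ : IsDensity μ ρ) (hBV : IsBV ρ) : ∃ V : ℝ, 0 ≤ V ∧ ShiftBound μ V := by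
  obtain ⟨V, hV, h⟩ := exists_integral_sub_shift_le hρ hBV
  refine ⟨V, hV, fun s B hB => ?_⟩
  have hms : Measurable fun t : ℝ => t + s := by fun_prop
  let μ' : Measure ℝ := μ.map fun t => t + s
  have : IsProbabilityMeasure μ' := Measure.isProbabilityMeasure_map hms.aemeasurable
  rw [← Measure.map_apply hms hB]
  refine ENNReal.le_of_forall_pos_le_add fun δ hδ _ => ?_
  have hδ' : ((δ / 2 : NNReal) : ENNReal) ≠ 0 := by
    simpa using hδ.ne'
  obtain ⟨K, hKB, hK, hKμ⟩ := hB.exists_isCompact_lt_add (measure_ne_top μ B) hδ'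
  obtain ⟨U, hKU, hU, hUμ⟩ := K.exists_isOpen_lt_add (measure_ne_top μ' K) hδ'
  obtain ⟨R, hR⟩ := hK.isBounded.subset_ball 0
  obtain ⟨f, hf0, hf1, hf⟩ := exists_contMDiffMap_zero_one_of_isClosed (n := ⊤)
    (modelWithCornersSelf ℝ ℝ) ((hU.inter (Metric.isOpen_ball (x := (0 : ℝ)) (ε := R))).isClosed_compl)
    hK.isClosed (Set.disjoint_left.2 fun x hx hxK => hx ⟨hKU hxK, hR hxK⟩)
  have hfd : ContDiff ℝ ((⊤ : ℕ∞) : WithTop ℕ∞) f := f.contMDiff.contDiff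
  have hfc : HasCompactSupport f := by
    refine HasCompactSupport.intro (isCompact_closedBall (0 : ℝ) R) fun t ht => hf0 ?_
    exact fun hx => ht (Metric.ball_subset_closedBall hx.2)
  have hint : ∀ (m : Measure ℝ) [IsFiniteMeasure m], Integrable f m := fun m _ =>
    Integrable.of_bound hfd.continuous.aestronglyMeasurable 1
      (Filter.Eventually.of_forall fun t => by
        rw [Real.norm_eq_abs, abs_of_nonneg (hf t).1]; exact (hf t).2)
  have h1 := h s f hfd hfc fun t => by rw [abs_of_nonneg (hf t).1]; exact (hf t).2
  have h2 : ∫ t, f (t + s) ∂μ = ∫ t, f t ∂μ' :=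
    (integral_map hms.aemeasurable hfd.continuous.aestronglyMeasurable).symm
  have h3 : μ.real K ≤ ∫ t, f t ∂μ := by
    rw [← integral_indicator_one hK.measurableSet]
    refine integral_mono ((integrable_const (1 : ℝ)).indicator hK.measurableSet) (hint μ) fun t => ?_
    by_cases ht : t ∈ K
    · simp [ht, hf1 ht]
    · simp [ht, (hf t).1]
  have h4 : ∫ t, f t ∂μ' ≤ μ'.real U := by
    rw [← integral_indicator_one hU.measurableSet]
    refine integral_mono (hint μ') ((integrable_const (1 : ℝ)).indicator hU.measurableSet) fun t => ?_
    by_cases ht : t ∈ U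
    · simp [ht, (hf t).2]
    · have := hf0 (x := t) (fun hx => ht hx.1)
      simp [ht, this]
  have h5 : μ K ≤ μ' U + ENNReal.ofReal (V * |s|) := by
    rw [← ofReal_measureReal (μ := μ), ← ofReal_measureReal (μ := μ'),
      ← ENNReal.ofReal_add measureReal_nonneg (by positivity)]
    exact ENNReal.ofReal_le_ofReal (by linarith)
  have h6 : (δ : ENNReal) = ((δ / 2 : NNReal) : ENNReal) + ((δ / 2 : NNReal) : ENNReal) := by
    rw [← ENNReal.coe_add, add_halves]
  calc μ B ≤ μ K + (δ / 2 : NNReal) := hKμ.le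
    _ ≤ (μ' U + ENNReal.ofReal (V * |s|)) + (δ / 2 : NNReal) := by gcongr
    _ ≤ ((μ' K + (δ / 2 : NNReal)) + ENNReal.ofReal (V * |s|)) + (δ / 2 : NNReal) := by
        gcongr
    _ ≤ (μ' B + (δ / 2 : NNReal) + ENNReal.ofReal (V * |s|)) + (δ / 2 : NNReal) := by
        gcongr
    _ = μ' B + ENNReal.ofReal (V * |s|) + δ := by rw [h6]; ring

/-- Fubini: with the other coordinates frozen, the one-dimensional bound applies to the section of
B. -/
theorem ShiftBound.pi_single {μ : Measure ℝ} [IsProbabilityMeasure μ] {V : ℝ}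
    (h : ShiftBound μ V) {ι : Type*} [Fintype ι] [DecidableEq ι] (i : ι) (s : ℝ)
    {B : Set (ι → ℝ)} (hB : MeasurableSet B) :
    Measure.pi (fun _ => μ) B ≤
      Measure.pi (fun _ => μ) ((fun x => x + Pi.single i s) ⁻¹' B) +
        ENNReal.ofReal (V * |s|) := by
  have hm : Measurable fun x : ι → ℝ => x + Pi.single i s := by fun_prop
  set c := ENNReal.ofReal (V * |s|)
  have key : ∀ x : ι → ℝ, ∫⁻ t, B.indicator 1 (Function.update x i t) ∂μ ≤
      ∫⁻ t, (((fun x => x + Pi.single i s) ⁻¹' B).indicator 1 (Function.update x i t) + c) ∂μ := by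
    intro x
    have hmu : Measurable fun t : ℝ => Function.update x i t := measurable_update x
    have e1 : ∀ (D : Set (ι → ℝ)) (t : ℝ), D.indicator (1 : (ι → ℝ) → ENNReal) (Function.update x i t) =
        ((fun t => Function.update x i t) ⁻¹' D).indicator (1 : ℝ → ENNReal) t := fun D t => rfl
    simp only [e1]
    rw [lintegral_add_right _ measurable_const, lintegral_const, measure_univ, mul_one,
      lintegral_indicator_one (hmu hB), lintegral_indicator_one (hmu (hm hB))]
    convert h s _ (hmu hB) using 3
    ext t
    simp only [mem_preimage]
    have : Function.update x i t + Pi.single i s = Function.update x i (t + s) := by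
      ext j
      by_cases hj : j = i
      · subst hj; simp
      · simp [hj]
    rw [this]
  have x0 : ι → ℝ := 0
  have hfin : ∀ D : Set (ι → ℝ), MeasurableSet D →
      Measurable (D.indicator (1 : (ι → ℝ) → ENNReal)) := fun D hD =>
    measurable_one.indicator hD
  calc Measure.pi (fun _ => μ) B
      = ∫⁻ x, B.indicator 1 x ∂Measure.pi (fun _ => μ) := (lintegral_indicator_one hB).symm
    _ = lmarginal (fun _ => μ) Finset.univ (B.indicator 1) x0 := by rw [lmarginal_univ]
    _ ≤ lmarginal (fun _ => μ) Finset.univ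
          (fun x => ((fun x => x + Pi.single i s) ⁻¹' B).indicator 1 x + c) x0 := by
        rw [lmarginal_erase' _ (hfin _ hB) (Finset.mem_univ i),
          lmarginal_erase' _ ((hfin _ (hm hB)).add_const c) (Finset.mem_univ i)]
        exact lmarginal_mono key x0
    _ = _ := by
        rw [lmarginal_univ, lintegral_add_right _ measurable_const, lintegral_const, measure_univ,
          mul_one, lintegral_indicator_one (hm hB)]

/-- The coordinates are moved one after the other, so the errors add up to the ℓ¹-norm of the shift.
-/
theorem ShiftBound.pi {μ : Measure ℝ} [IsProbabilityMeasure μ] {V : ℝ} (hV : 0 ≤ V)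
    (h : ShiftBound μ V) {ι : Type*} [Fintype ι] (a : ι → ℝ)
    {B : Set (ι → ℝ)} (hB : MeasurableSet B) :
    Measure.pi (fun _ => μ) B ≤
      Measure.pi (fun _ => μ) ((fun x => x + a) ⁻¹' B) + ENNReal.ofReal (V * ∑ i, |a i|) := by
  classical
  suffices H : ∀ s : Finset ι, Measure.pi (fun _ => μ) B ≤
      Measure.pi (fun _ => μ) ((fun x => x + ∑ i ∈ s, Pi.single i (a i)) ⁻¹' B) +
        ENNReal.ofReal (V * ∑ i ∈ s, |a i|) by
    have := H Finset.univ
    rwa [Finset.univ_sum_single] at this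
  intro s
  induction s using Finset.induction_on with
  | empty => simp
  | insert i s hi ih =>
    rw [Finset.sum_insert hi, Finset.sum_insert hi, mul_add,
      ENNReal.ofReal_add (by positivity) (by positivity), ← add_assoc]
    refine ih.trans ?_
    gcongr
    have hm : Measurable fun x : ι → ℝ => x + ∑ i ∈ s, Pi.single i (a i) := by fun_prop
    refine (h.pi_single i (a i) (hm hB)).trans ?_
    gcongr
    rw [← preimage_comp]
    apply subset_of_eq
    ext x
    simp

end AlloyMSA

/-! ### Resonant matrices and eigenvalue counting -/

namespace AlloyMSA

open Matrix

variable {n : Type*} [Fintype n]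

/-- `H - E` has an approximate null vector, up to a relative error `ε` in the Euclidean norm. -/
def Resonant (H : Matrix n n ℝ) (E ε : ℝ) : Prop :=
  ∃ φ : n → ℝ, φ ≠ 0 ∧ ∑ i, ((H *ᵥ φ) i - E * φ i) ^ 2 ≤ ε ^ 2 * ∑ i, φ i ^ 2

/-- The factor 2 comes from (a + b)² ≤ 2a² + 2b². Allowing a diagonal difference v covers a change
of the potential and a change of the energy at once. -/
theorem Resonant.perturb {H H' : Matrix n n ℝ} {E E' ε : ℝ} {v : n → ℝ}
    (h : Resonant H E ε) (hv : ∀ i, |v i| ≤ ε)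
    (hH : ∀ φ i, (H' *ᵥ φ) i - E' * φ i = (H *ᵥ φ) i - E * φ i + v i * φ i) :
    Resonant H' E' (2 * ε) := by
  obtain ⟨φ, h0, h⟩ := h
  refine ⟨φ, h0, ?_⟩
  have h1 : ∀ i, ((H' *ᵥ φ) i - E' * φ i) ^ 2 ≤
      2 * ((H *ᵥ φ) i - E * φ i) ^ 2 + 2 * (ε ^ 2 * φ i ^ 2) := by
    intro i
    rw [hH]
    have h2 : (v i * φ i) ^ 2 ≤ ε ^ 2 * φ i ^ 2 := by
      rw [mul_pow]
      exact mul_le_mul_of_nonneg_right (sq_le_sq.2 ((hv i).trans (le_abs_self ε))) (sq_nonneg _)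
    nlinarith [sq_nonneg ((H *ᵥ φ) i - E * φ i - v i * φ i)]
  calc ∑ i, ((H' *ᵥ φ) i - E' * φ i) ^ 2
      ≤ ∑ i, (2 * ((H *ᵥ φ) i - E * φ i) ^ 2 + 2 * (ε ^ 2 * φ i ^ 2)) :=
        Finset.sum_le_sum fun i _ => h1 i
    _ = 2 * ∑ i, ((H *ᵥ φ) i - E * φ i) ^ 2 + 2 * (ε ^ 2 * ∑ i, φ i ^ 2) := by
        rw [Finset.sum_add_distrib, Finset.mul_sum, Finset.mul_sum, Finset.mul_sum]
    _ ≤ (2 * ε) ^ 2 * ∑ i, φ i ^ 2 := by nlinarith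

theorem Resonant.energy {H : Matrix n n ℝ} {E E' ε : ℝ} (h : Resonant H E ε)
    (hE : |E - E'| ≤ ε) : Resonant H E' (2 * ε) :=
  h.perturb (v := fun _ => E - E') (fun _ => hE) fun φ i => by ring

/-- If all eigenvalues were farther than ε from E, then H - E would stretch φ by more than ε, by
Parseval in the eigenbasis. -/
theorem Resonant.exists_eigenvalue [DecidableEq n] {H : Matrix n n ℝ} (hH : H.IsHermitian)
    {E ε : ℝ} (h : Resonant H E ε) (hε : 0 ≤ ε) : ∃ i, |hH.eigenvalues i - E| ≤ ε := by
  obtain ⟨φ, h0, h⟩ := h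
  by_contra! hcon
  set b := hH.eigenvectorBasis
  have hpars : ∀ ψ : n → ℝ, ∑ i, ψ i ^ 2 = ∑ i, ((b i).ofLp ⬝ᵥ ψ) ^ 2 := by
    intro ψ
    have h1 := b.sum_sq_norm_inner_right (WithLp.toLp 2 ψ)
    rw [EuclideanSpace.norm_sq_eq] at h1
    simp only [Real.norm_eq_abs, sq_abs] at h1
    rw [← h1]
    refine Finset.sum_congr rfl fun i _ => ?_
    rw [EuclideanSpace.inner_eq_star_dotProduct, dotProduct_comm]
    simp
  have hinner : ∀ i, ((b i).ofLp ⬝ᵥ (H *ᵥ φ - E • φ)) =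
      (hH.eigenvalues i - E) * ((b i).ofLp ⬝ᵥ φ) := by
    intro i
    have h2 : (b i).ofLp ᵥ* H = hH.eigenvalues i • (b i).ofLp := by
      rw [← hH.mulVec_eigenvectorBasis i]
      have : Hᵀ = H := by simpa using hH.eq
      conv_lhs => rw [← this, vecMul_transpose]
    rw [dotProduct_sub, dotProduct_mulVec, h2, smul_dotProduct, dotProduct_smul]
    simp only [smul_eq_mul]
    ring
  have h3 : ∑ i, ((H *ᵥ φ) i - E * φ i) ^ 2 = ∑ i, (hH.eigenvalues i - E) ^ 2 *
      ((b i).ofLp ⬝ᵥ φ) ^ 2 := by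
    have := hpars (H *ᵥ φ - E • φ)
    simp only [hinner, mul_pow] at this
    simpa using this
  rw [h3, hpars φ, Finset.mul_sum] at h
  have hpos : 0 < ∑ i, ((b i).ofLp ⬝ᵥ φ) ^ 2 := by
    rw [← hpars]
    obtain ⟨i, hi⟩ := Function.ne_iff.1 h0
    exact Finset.sum_pos' (fun _ _ => sq_nonneg _) ⟨i, Finset.mem_univ _, by
      have : φ i ≠ 0 := hi
      positivity⟩
  have hsq : ∀ i, ε ^ 2 < (hH.eigenvalues i - E) ^ 2 := fun i => by
    rw [← sq_abs (hH.eigenvalues i - E)]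
    exact pow_lt_pow_left₀ (hcon i) hε two_ne_zero
  obtain ⟨i, _, hi⟩ := Finset.exists_lt_of_sum_lt (s := Finset.univ)
    (f := fun _ : n => (0 : ℝ)) (by simpa using hpos)
  refine absurd h (not_le.2 (Finset.sum_lt_sum (fun j _ => ?_) ⟨i, Finset.mem_univ _, ?_⟩))
  · have := (hsq j).le
    gcongr
  · exact mul_lt_mul_of_pos_right (hsq i) hi

theorem isUnit_det_of_not_resonant [DecidableEq n] {H : Matrix n n ℝ} {E ε : ℝ}
    (h : ¬ Resonant H E ε) : IsUnit (H - E • (1 : Matrix n n ℝ)).det := by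
  rw [isUnit_iff_ne_zero]
  intro h0
  obtain ⟨φ, hφ, hz⟩ := exists_mulVec_eq_zero_iff.2 h0
  refine h ⟨φ, hφ, ?_⟩
  have h1 : ∀ i, (H *ᵥ φ) i - E * φ i = 0 := fun i => by
    have := congrFun hz i
    simpa [sub_mulVec, smul_mulVec] using this
  simp only [h1]
  simpa using mul_nonneg (sq_nonneg ε) (Finset.sum_nonneg fun i _ => sq_nonneg (φ i))

theorem notMem_spectrum_of_isUnit_det [DecidableEq n] {H : Matrix n n ℝ} {E : ℝ}
    (h : IsUnit (H - E • (1 : Matrix n n ℝ)).det) : E ∉ spectrum ℝ H := by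
  rw [spectrum.notMem_iff, ← IsUnit.neg_iff, neg_sub, Algebra.algebraMap_eq_smul_one]
  exact (isUnit_iff_isUnit_det _).2 h

theorem isUnit_det_of_notMem_spectrum [DecidableEq n] {H : Matrix n n ℝ} {E : ℝ}
    (h : E ∉ spectrum ℝ H) : IsUnit (H - E • (1 : Matrix n n ℝ)).det := by
  rw [spectrum.notMem_iff, ← IsUnit.neg_iff, neg_sub, Algebra.algebraMap_eq_smul_one] at h
  exact (isUnit_iff_isUnit_det _).1 h

/-- H - E maps a column of its inverse to a unit vector, so a column longer than 1/ε would witness a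
resonance. -/
theorem abs_resolvent_le_of_not_resonant [DecidableEq n] {H : Matrix n n ℝ} {E ε : ℝ}
    (hε : 0 < ε) (h : ¬ Resonant H E ε) (x y : n) :
    |(H - E • (1 : Matrix n n ℝ))⁻¹ x y| ≤ 1 / ε := by
  set G := (H - E • (1 : Matrix n n ℝ))⁻¹
  have hG : (H - E • (1 : Matrix n n ℝ)) * G = 1 := mul_nonsing_inv _ (isUnit_det_of_not_resonant h)
  set φ : n → ℝ := G.col y
  have h1 : ∀ i, (H *ᵥ φ) i - E * φ i = (1 : Matrix n n ℝ) i y := fun i => by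
    have h2 : (H - E • (1 : Matrix n n ℝ)) *ᵥ φ = fun i => (1 : Matrix n n ℝ) i y := by
      funext j
      rw [← congrFun (congrFun hG j) y]
      rfl
    simpa [sub_mulVec, smul_mulVec] using congrFun h2 i
  have hs : ∑ i, ((H *ᵥ φ) i - E * φ i) ^ 2 = 1 := by
    simp [h1, one_apply]
  have hφ : φ ≠ 0 := by
    intro h0
    simp [h0] at hs
  have h2 : ε ^ 2 * ∑ i, φ i ^ 2 < 1 := by
    by_contra hcon
    exact h ⟨φ, hφ, by rw [hs]; exact not_lt.1 hcon⟩
  have h3 : φ x ^ 2 ≤ ∑ i, φ i ^ 2 :=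
    Finset.single_le_sum (f := fun i => φ i ^ 2) (fun i _ => sq_nonneg _) (Finset.mem_univ x)
  have h4 : (ε * |φ x|) ^ 2 ≤ 1 ^ 2 := by
    rw [mul_pow, sq_abs]
    nlinarith [sq_nonneg ε]
  rw [le_div_iff₀ hε, mul_comm]
  exact (le_abs_self _).trans (abs_le_of_sq_le_sq h4 zero_le_one)

/-- There is a `k`-dimensional subspace on which the quadratic form of `H` is at most `t`. -/
def HasSubspaceBelow (H : Matrix n n ℝ) (t : ℝ) (k : ℕ) : Prop :=
  ∃ V : Submodule ℝ (n → ℝ), Module.finrank ℝ V = k ∧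
    ∀ ψ ∈ V, ψ ⬝ᵥ (H *ᵥ ψ) ≤ t * (ψ ⬝ᵥ ψ)

theorem HasSubspaceBelow.le_card {H : Matrix n n ℝ} {t : ℝ} {k : ℕ}
    (h : HasSubspaceBelow H t k) : k ≤ Fintype.card n := by
  obtain ⟨V, rfl, -⟩ := h
  simpa using Submodule.finrank_le V

/-- An eigenvector e of H with eigenvalue t within ε of E is adjoined to V. The gap 3ε pushes the
form of H on V below E - 2ε < t, so e is not in V. -/
theorem HasSubspaceBelow.succ [DecidableEq n] {H H' : Matrix n n ℝ} (hH : H.IsHermitian)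
    {E ε : ℝ} (hε : 0 < ε)
    (hle : ∀ ψ, ψ ⬝ᵥ (H *ᵥ ψ) + 3 * ε * (ψ ⬝ᵥ ψ) ≤ ψ ⬝ᵥ (H' *ᵥ ψ)) (hr : Resonant H E ε)
    {k : ℕ} (h : HasSubspaceBelow H' (E + ε) k) : HasSubspaceBelow H (E + ε) (k + 1) := by
  obtain ⟨V, rfl, hV⟩ := h
  obtain ⟨i, hi⟩ := hr.exists_eigenvalue hH hε.le
  set t := hH.eigenvalues i
  set e : n → ℝ := (hH.eigenvectorBasis i).ofLp
  have he : H *ᵥ e = t • e := hH.mulVec_eigenvectorBasis i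
  have he0 : e ≠ 0 := by
    intro h0
    have := hH.eigenvectorBasis.toBasis.ne_zero i
    apply this
    ext j
    simpa using congrFun h0 j
  have hpos : ∀ ψ : n → ℝ, 0 ≤ ψ ⬝ᵥ ψ := fun ψ =>
    Finset.sum_nonneg fun i _ => mul_self_nonneg (ψ i)
  have hee : 0 < e ⬝ᵥ e := lt_of_le_of_ne (hpos e) fun h => he0 (dotProduct_self_eq_zero.1 h.symm)
  have hi' := abs_le.1 hi
  have hVH : ∀ ψ ∈ V, ψ ⬝ᵥ (H *ᵥ ψ) ≤ (E - 2 * ε) * (ψ ⬝ᵥ ψ) := fun ψ hψ => by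
    nlinarith [hV ψ hψ, hle ψ]
  have heV : e ∉ V := by
    intro hmem
    have := hVH e hmem
    rw [he, dotProduct_smul, smul_eq_mul] at this
    nlinarith
  refine ⟨V ⊔ Submodule.span ℝ {e}, ?_, ?_⟩
  · have hdis : V ⊓ Submodule.span ℝ {e} = ⊥ := by
      rw [← disjoint_iff]
      exact (Submodule.disjoint_span_singleton' he0).2 heV
    have := Submodule.finrank_sup_add_finrank_inf_eq V (Submodule.span ℝ {e})
    rw [hdis, finrank_bot, finrank_span_singleton he0] at this
    simpa using this
  · intro ψ hψ
    obtain ⟨v, hv, w, hw, rfl⟩ := Submodule.mem_sup.1 hψ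
    obtain ⟨c, rfl⟩ := Submodule.mem_span_singleton.1 hw
    have hsym : e ⬝ᵥ (H *ᵥ v) = t * (e ⬝ᵥ v) := by
      have hT : Hᵀ = H := by simpa using hH.eq
      rw [dotProduct_mulVec, ← hT, vecMul_transpose, he, smul_dotProduct, smul_eq_mul]
    -- As (H - t)e = 0, the form of H - t at v + c e equals its value at v, which is not positive.
    have h1 : (v + c • e) ⬝ᵥ (H *ᵥ (v + c • e)) = v ⬝ᵥ (H *ᵥ v) - t * (v ⬝ᵥ v) +
        t * ((v + c • e) ⬝ᵥ (v + c • e)) := by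
      simp only [mulVec_add, mulVec_smul, he, add_dotProduct, dotProduct_add, smul_dotProduct,
        dotProduct_smul, smul_eq_mul, hsym, dotProduct_comm v e]
      ring
    rw [h1]
    nlinarith [hVH v hv, hpos v, hpos (v + c • e)]

open Classical in
/-- Along a sequence of symmetric matrices with increments at least `3 ε`, an energy `E` is
`ε`-resonant at most as often as the size of the matrices. -/
theorem card_resonant_le [DecidableEq n] (H : ℕ → Matrix n n ℝ) (hH : ∀ j, (H j).IsHermitian)
    {E ε : ℝ} (hε : 0 < ε)
    (hle : ∀ j ψ, ψ ⬝ᵥ (H j *ᵥ ψ) + 3 * ε * (ψ ⬝ᵥ ψ) ≤ ψ ⬝ᵥ (H (j + 1) *ᵥ ψ)) (J : ℕ) :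
    ((Finset.range J).filter fun j => Resonant (H j) E ε).card ≤ Fintype.card n := by
  -- `k j` is the largest dimension of a subspace below E + ε. It never increases with j and drops
  -- at every resonant j, so the resonances are counted by `k 0`.
  let k : ℕ → ℕ := fun j =>
    Nat.findGreatest (fun k => HasSubspaceBelow (H j) (E + ε) k) (Fintype.card n)
  have hk : ∀ j, HasSubspaceBelow (H j) (E + ε) (k j) := fun j =>
    Nat.findGreatest_spec (P := fun k => HasSubspaceBelow (H j) (E + ε) k) (m := 0) (Nat.zero_le _)
      ⟨⊥, by simp, fun ψ hψ => by simp [(Submodule.mem_bot ℝ).1 hψ]⟩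
  have hmax : ∀ j q, HasSubspaceBelow (H j) (E + ε) q → q ≤ k j := fun j q hq =>
    Nat.le_findGreatest hq.le_card hq
  have hpos : ∀ ψ : n → ℝ, 0 ≤ ψ ⬝ᵥ ψ := fun ψ =>
    Finset.sum_nonneg fun i _ => mul_self_nonneg (ψ i)
  have hanti : ∀ j, k (j + 1) ≤ k j := fun j => hmax j _ <| by
    obtain ⟨V, hV, h⟩ := hk (j + 1)
    exact ⟨V, hV, fun ψ hψ => by nlinarith [h ψ hψ, hle j ψ, hpos ψ]⟩
  suffices ((Finset.range J).filter fun j => Resonant (H j) E ε).card + k J ≤ k 0 from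
    (Nat.le_add_right _ _).trans (this.trans (hk 0).le_card)
  induction J with
  | zero => simp
  | succ J ih =>
    rw [Finset.range_add_one, Finset.filter_insert]
    split_ifs with hr
    · rw [Finset.card_insert_of_notMem (by simp)]
      have := hmax J _ ((hk (J + 1)).succ (hH J) hε (hle J) hr)
      omega
    · have := hanti J
      omega

end AlloyMSA

/-! ### A direction along which the potential changes by a constant -/

namespace AlloyMSA

open ProbabilityTheory

theorem summable_abs_mul_pow {ι : Type*} {w x : ι → ℝ} {δ : ℝ} (hδ : 0 < δ)
    (hs : Summable fun j => |w j| * Real.exp (δ * |x j|)) (n : ℕ) :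
    Summable fun j => |w j| * |x j| ^ n := by
  refine Summable.of_nonneg_of_le (fun j => by positivity) (fun j => ?_)
    (hs.mul_left (n.factorial / δ ^ n))
  have h1 := Real.pow_div_factorial_le_exp (δ * |x j|) (by positivity) n
  rw [div_le_iff₀ (by positivity), mul_pow] at h1
  have h2 : |x j| ^ n ≤ n.factorial / δ ^ n * Real.exp (δ * |x j|) := by
    rw [div_mul_eq_mul_div, le_div_iff₀ (by positivity)]
    linarith
  calc |w j| * |x j| ^ n ≤ |w j| * (n.factorial / δ ^ n * Real.exp (δ * |x j|)) := by gcongr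
    _ = _ := by ring

/-- A discrete signed measure on `ℝ` with exponential moments all of whose moments vanish is
zero. -/
theorem eq_zero_of_moments_eq_zero {ι : Type*} [Countable ι] {w x : ι → ℝ} {δ : ℝ} (hδ : 0 < δ)
    (hx : Function.Injective x) (hs : Summable fun j => |w j| * Real.exp (δ * |x j|))
    (hm : ∀ n : ℕ, ∑' j, w j * x j ^ n = 0) : w = 0 := by
  -- `ENNReal.ofReal` truncates at zero, so `ν w` and `ν (-w)` are the positive and negative parts.
  -- Their moments agree, hence their complex moment generating functions agree near 0, then on the
  -- strip |Re z| < δ by the identity theorem, and the imaginary axis gives equal characteristic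
  -- functions.
  let ν : (ι → ℝ) → Measure ℝ := fun w =>
    Measure.sum fun j => ENNReal.ofReal (w j) • Measure.dirac (x j)
  have hle : ∀ s : ℝ, (ENNReal.ofReal s).toReal ≤ |s| := fun s => by
    rw [ENNReal.toReal_ofReal']
    exact max_le (le_abs_self s) (abs_nonneg s)
  have hint : ∀ v : ι → ℝ, (∀ j, |v j| = |w j|) → ∀ f : ℝ → ℝ,
      (∀ t, |f t| ≤ Real.exp (δ * |t|)) → Integrable f (ν v) := by
    intro v hv f hf
    refine (integrable_sum_dirac_iff (by simp)).2 (Summable.of_nonneg_of_le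
      (fun j => by positivity) (fun j => ?_) hs)
    rw [← hv j]
    exact mul_le_mul (hle _) (hf _) (by positivity) (by positivity)
  have hfin : ∀ v : ι → ℝ, (∀ j, |v j| = |w j|) → IsFiniteMeasure (ν v) := fun v hv => by
    have := hint v hv (fun _ => 1) fun t => by
      simpa using mul_nonneg hδ.le (abs_nonneg t)
    exact (integrable_const_iff_isFiniteMeasure one_ne_zero).1 this
  have hexp : ∀ v : ι → ℝ, (∀ j, |v j| = |w j|) →
      Ioo (-δ) δ ⊆ interior (integrableExpSet id (ν v)) := fun v hv => by
    refine interior_maximal (fun t ht => ?_) isOpen_Ioo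
    refine hint v hv _ fun s => ?_
    rw [Real.abs_exp, Real.exp_le_exp]
    calc t * s ≤ |t * s| := le_abs_self _
      _ = |t| * |s| := abs_mul _ _
      _ ≤ δ * |s| := by gcongr; exact (abs_lt.2 ht).le
  have hw : ∀ j, |w j| = |w j| := fun _ => rfl
  have hw' : ∀ j, |(-w) j| = |w j| := fun j => abs_neg _
  have := hfin w hw
  have := hfin (-w) hw'
  have h0 : (0 : ℝ) ∈ Ioo (-δ) δ := by simp [hδ]
  have hmom : ∀ n : ℕ, ∫ t, ((id t : ℝ) : ℂ) ^ n * Complex.exp (0 * (id t : ℝ)) ∂(ν w) =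
      ∫ t, ((id t : ℝ) : ℂ) ^ n * Complex.exp (0 * (id t : ℝ)) ∂(ν (-w)) := by
    intro n
    have hr : ∀ v : ι → ℝ, ∫ t, ((id t : ℝ) : ℂ) ^ n * Complex.exp (0 * (id t : ℝ)) ∂(ν v) =
        ((∑' j, (ENNReal.ofReal (v j)).toReal * x j ^ n : ℝ) : ℂ) := by
      intro v
      have h1 : (fun t : ℝ => ((id t : ℝ) : ℂ) ^ n * Complex.exp (0 * (id t : ℝ))) =
          fun t : ℝ => ((t ^ n : ℝ) : ℂ) := by
        ext t; simp
      rw [h1, integral_complex_ofReal, integral_sum_dirac (by simp)]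
      simp
    rw [hr, hr]
    congr 1
    have hsum : ∀ v : ι → ℝ, (∀ j, |v j| = |w j|) →
        Summable fun j => (ENNReal.ofReal (v j)).toReal * x j ^ n := by
      intro v hv
      refine Summable.of_norm_bounded (summable_abs_mul_pow hδ hs n) fun j => ?_
      rw [norm_mul, norm_pow, Real.norm_eq_abs, Real.norm_eq_abs, ENNReal.abs_toReal, ← hv j]
      gcongr
      exact hle _
    rw [← sub_eq_zero, ← (hsum w hw).tsum_sub (hsum _ hw'), ← hm n]
    refine tsum_congr fun j => ?_
    rw [ENNReal.toReal_ofReal', ENNReal.toReal_ofReal', ← sub_mul]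
    congr 1
    simp only [Pi.neg_apply]
    rcases le_total 0 (w j) with h | h
    · rw [max_eq_left h, max_eq_right (by linarith), sub_zero]
    · rw [max_eq_right h, max_eq_left (by linarith)]; ring
  have hre0 : ∀ v : ι → ℝ, (∀ j, |v j| = |w j|) →
      (0 : ℂ).re ∈ interior (integrableExpSet id (ν v)) := fun v hv => by
    simpa using hexp v hv h0
  have hev : complexMGF id (ν w) =ᶠ[nhds 0] complexMGF id (ν (-w)) := by
    have h1 := (analyticAt_complexMGF (hre0 w hw)).hasFPowerSeriesAt
    have h2 := (analyticAt_complexMGF (hre0 (-w) hw')).hasFPowerSeriesAt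
    have h3 : ∀ n, iteratedDeriv n (complexMGF id (ν w)) 0 =
        iteratedDeriv n (complexMGF id (ν (-w))) 0 := fun n => by
      rw [iteratedDeriv_complexMGF (hre0 w hw), iteratedDeriv_complexMGF (hre0 _ hw')]
      exact hmom n
    simp only [h3] at h1
    have h4 := h1.sub h2
    rw [sub_self] at h4
    filter_upwards [h4.eventually_eq_zero] with z hz
    exact sub_eq_zero.1 hz
  let S : Set ℂ := {z | z.re ∈ Ioo (-δ) δ}
  have han : ∀ v : ι → ℝ, (∀ j, |v j| = |w j|) → AnalyticOnNhd ℂ (complexMGF id (ν v)) S :=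
    fun v hv => analyticOnNhd_complexMGF.mono fun z hz => hexp v hv hz
  have hpre : IsPreconnected S :=
    ((convex_Ioo (-δ) δ).linear_preimage Complex.reLm).isPreconnected
  have heq := (han w hw).eqOn_of_preconnected_of_eventuallyEq (han (-w) hw') hpre
    (z₀ := 0) (by simpa [S] using hδ) hev
  have hν : ν w = ν (-w) := by
    refine Measure.ext_of_charFun (funext fun t => ?_)
    rw [← complexMGF_id_mul_I, ← complexMGF_id_mul_I]
    exact heq (by simpa [S] using hδ)
  ext j
  have h5 : ∀ v : ι → ℝ, ν v {x j} = ENNReal.ofReal (v j) := fun v => by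
    rw [Measure.sum_apply _ (measurableSet_singleton _), tsum_eq_single j]
    · simp
    · intro i hi
      have : x i ≠ x j := fun h => hi (hx h)
      simp [this]
  have h6 := congrArg (fun m => m {x j}) hν
  simp only [h5, Pi.neg_apply] at h6
  rcases le_total 0 (w j) with h | h
  · rw [ENNReal.ofReal_of_nonpos (by linarith : -w j ≤ 0), ENNReal.ofReal_eq_zero] at h6
    exact le_antisymm h6 h
  · rw [ENNReal.ofReal_of_nonpos h, eq_comm, ENNReal.ofReal_eq_zero] at h6
    exact le_antisymm h (by simpa using h6)

theorem summable_pi_prod_of_nonneg {f : ℤ → ℝ} (h0 : ∀ k, 0 ≤ f k) (hf : Summable f) (d : ℕ) :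
    Summable fun k : Fin d → ℤ => ∏ i, f (k i) := by
  induction d with
  | zero => exact (hasSum_fintype _).summable
  | succ d ih =>
    rw [← (Fin.consEquiv fun _ => ℤ).summable_iff]
    have := hf.mul_of_nonneg ih h0 fun k => Finset.prod_nonneg fun i _ => h0 _
    refine this.congr fun p => ?_
    simp [Fin.prod_univ_succ]

theorem summable_exp_norm1 (d : ℕ) {c : ℝ} (hc : 0 < c) :
    Summable fun k : Site d => Real.exp (-c * (norm1 k : ℝ)) := by
  have h1 : Summable fun k : ℤ => Real.exp (-c * |(k : ℝ)|) := by
    have hgeo : Summable fun n : ℕ => Real.exp (-c * (n : ℝ)) := by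
      have := summable_geometric_of_lt_one (Real.exp_pos (-c)).le
        (by simpa using hc)
      refine this.congr fun n => ?_
      rw [← Real.exp_nat_mul]
      congr 1
      ring
    exact Summable.of_nat_of_neg (by simpa using hgeo) (by simpa using hgeo)
  refine (summable_pi_prod_of_nonneg (fun k => (Real.exp_pos _).le) h1 d).congr fun k => ?_
  rw [← Real.exp_sum, ← Finset.mul_sum]
  simp [norm1]

theorem norm1_nonneg {d : ℕ} (k : Site d) : 0 ≤ norm1 k :=
  Finset.sum_nonneg fun _ _ => abs_nonneg _

/-- The powers of a transcendental number are linearly independent over ℤ. -/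
theorem exists_injective_linear (d : ℕ) :
    ∃ θ : Fin d → ℝ, Function.Injective fun k : Site d => ∑ i, θ i * (k i : ℝ) := by
  have ht := transcendental_liouvilleNumber (m := 2) le_rfl
  set t := liouvilleNumber 2
  refine ⟨fun i => t ^ (i : ℕ), fun k k' hk => ?_⟩
  let p : Polynomial ℤ := ∑ i : Fin d, Polynomial.monomial (i : ℕ) (k i - k' i)
  have hp : Polynomial.aeval t p = 0 := by
    simp only [p, map_sum, Polynomial.aeval_monomial]
    have : ∑ i : Fin d, t ^ (i : ℕ) * (k i : ℝ) - ∑ i : Fin d, t ^ (i : ℕ) * (k' i : ℝ) = 0 :=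
      sub_eq_zero.2 hk
    rw [← Finset.sum_sub_distrib] at this
    rw [← this]
    refine Finset.sum_congr rfl fun i _ => ?_
    simp
    ring
  have hp0 : p = 0 := by
    by_contra hne
    exact ht ⟨p, hne, hp⟩
  ext i
  have hc := congrArg (fun q => Polynomial.coeff q (i : ℕ)) hp0
  simp only [p, Polynomial.finsetSum_coeff, Polynomial.coeff_monomial, Polynomial.coeff_zero] at hc
  rw [Finset.sum_eq_single i] at hc
  · simp at hc; omega
  · intro j _ hj
    rw [if_neg fun h => hj (Fin.ext h)]
  · simp

theorem abs_linear_le {d : ℕ} (θ : Fin d → ℝ) (k : Site d) :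
    |∑ i, θ i * (k i : ℝ)| ≤ (∑ i, |θ i|) * (norm1 k : ℝ) := by
  refine (Finset.abs_sum_le_sum_abs _ _).trans ?_
  rw [Finset.sum_mul]
  refine Finset.sum_le_sum fun i _ => ?_
  rw [abs_mul]
  refine mul_le_mul_of_nonneg_left ?_ (abs_nonneg _)
  have : |k i| ≤ norm1 k :=
    Finset.single_le_sum (f := fun i => |k i|) (fun _ _ => abs_nonneg _) (Finset.mem_univ i)
  exact_mod_cast this

/-- For an exponentially decaying `u ≠ 0` there is a polynomial whose convolution with `u` is a
non-zero constant. -/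
theorem exists_direction {d : ℕ} {u : Site d → ℝ} (hu : ExpDecay u) (hu0 : u ≠ 0) :
    ∃ (θ : Fin d → ℝ) (n : ℕ) (c : ℝ), c ≠ 0 ∧ ∀ x₀ x : Site d,
      HasSum (fun k => (∑ i, θ i * ((k - x₀) i : ℝ)) ^ n * u (x - k)) c := by
  obtain ⟨θ, hθ⟩ := exists_injective_linear d
  obtain ⟨C, α, hC, hα, hb⟩ := hu
  set ℓ : Site d → ℝ := fun k => ∑ i, θ i * (k i : ℝ)
  set Θ : ℝ := (∑ i, |θ i|) + 1
  have hΘ : 0 < Θ := by positivity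
  -- Half of the decay rate α pays for the exponential moment, the other half for summability.
  have hsum : Summable fun j => |u j| * Real.exp (α / 2 / Θ * |ℓ j|) := by
    refine Summable.of_nonneg_of_le (fun j => by positivity) (fun j => ?_)
      ((summable_exp_norm1 d (half_pos hα)).mul_left C)
    have h1 : |ℓ j| ≤ Θ * norm1 j := (abs_linear_le θ j).trans <| by
      have := norm1_nonneg j
      gcongr
      simp [Θ]
    have h2 : α / 2 / Θ * |ℓ j| ≤ α / 2 * norm1 j := by
      calc α / 2 / Θ * |ℓ j| ≤ α / 2 / Θ * (Θ * norm1 j) := by gcongr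
        _ = _ := by field_simp
    calc |u j| * Real.exp (α / 2 / Θ * |ℓ j|)
        ≤ C * Real.exp (-α * norm1 j) * Real.exp (α / 2 * norm1 j) := by
          gcongr
          exact hb j
      _ = _ := by
          rw [mul_assoc, ← Real.exp_add]
          congr 2
          ring
  -- Injectivity of ℓ puts the atoms `u j` at distinct points, so they cannot cancel.
  have hex : ∃ n : ℕ, ∑' j, u j * ℓ j ^ n ≠ 0 := by
    by_contra! hcon
    exact hu0 (eq_zero_of_moments_eq_zero (by positivity) hθ hsum hcon)
  classical
  -- With k = x - j the weight is (y - ℓ j)^n. In its binomial expansion the moments of order p < n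
  -- vanish by minimality of n, and the term p = n contains neither x nor x₀.
  set n := Nat.find hex
  have hn : ∑' j, u j * ℓ j ^ n ≠ 0 := Nat.find_spec hex
  have hlt : ∀ p < n, ∑' j, u j * ℓ j ^ p = 0 := fun p hp => not_not.1 (Nat.find_min hex hp)
  have hs : ∀ p, Summable fun j => u j * ℓ j ^ p := fun p =>
    Summable.of_norm_bounded (summable_abs_mul_pow (by positivity) hsum p) fun j => by
      simp
  refine ⟨θ, n, (-1) ^ n * ∑' j, u j * ℓ j ^ n, by simpa using hn, fun x₀ x => ?_⟩
  rw [← (Equiv.subLeft x).hasSum_iff]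
  set y : ℝ := ℓ (x - x₀)
  have hexpand : ∀ j, (∑ i, θ i * (((Equiv.subLeft x j : Site d) - x₀) i : ℝ)) ^ n *
      u (x - Equiv.subLeft x j) =
      ∑ p ∈ Finset.range (n + 1), ((-1) ^ p * y ^ (n - p) * (n.choose p)) * (u j * ℓ j ^ p) := by
    intro j
    have h1 : (∑ i, θ i * (((Equiv.subLeft x j : Site d) - x₀) i : ℝ)) = -ℓ j + y := by
      simp only [ℓ, y, ← Finset.sum_neg_distrib, ← Finset.sum_add_distrib]
      refine Finset.sum_congr rfl fun i _ => ?_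
      simp
      ring
    rw [h1, add_pow, Finset.sum_mul]
    refine Finset.sum_congr rfl fun p _ => ?_
    rw [neg_pow]
    simp
    ring
  have h2 : HasSum (fun j => ∑ p ∈ Finset.range (n + 1),
      ((-1) ^ p * y ^ (n - p) * (n.choose p)) * (u j * ℓ j ^ p))
      (∑ p ∈ Finset.range (n + 1),
        ((-1) ^ p * y ^ (n - p) * (n.choose p)) * ∑' j, u j * ℓ j ^ p) :=
    hasSum_sum fun p _ => ((hs p).hasSum.mul_left _)
  rw [Finset.sum_range_succ, Finset.sum_eq_zero fun p hp => by
    rw [hlt p (Finset.mem_range.1 hp), mul_zero]] at h2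
  simp only [Nat.sub_self, pow_zero, mul_one, Nat.choose_self, Nat.cast_one, zero_add] at h2
  exact h2.congr_fun fun j => (hexpand j)

end AlloyMSA

/-! ### Box matrices and tails of the single-site potential -/

namespace AlloyMSA

variable {d : ℕ}

/-- The matrix entries of `h₀ + v` for a potential `v`. -/
noncomputable def latticeEntry (v : Site d → ℝ) (x y : Site d) : ℝ :=
  (∑ z ∈ neighbors x, ((Pi.single y 1 : Site d → ℝ) x - (Pi.single y 1 : Site d → ℝ) z)) +
    v x * (Pi.single y 1 : Site d → ℝ) x

/-- The restriction of `h₀ + v` to a finite set. -/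
noncomputable def boxMatrix (v : Site d → ℝ) (S : Finset (Site d)) : Matrix S S ℝ :=
  Matrix.of fun x y => latticeEntry v x y

/-- Matrices with an arbitrary potential are needed because the translated couplings may leave the
support of μ. -/
theorem boxHamiltonian_eq {μ : Measure ℝ} (u : Site d → ℝ) (ω : Config d μ)
    (S : Finset (Site d)) : boxHamiltonian u ω S = boxMatrix (potential u ω) S := rfl

theorem norm1_sub_comm (x y : Site d) : norm1 (x - y) = norm1 (y - x) := by
  simp only [norm1, Pi.sub_apply]
  exact Finset.sum_congr rfl fun i _ => abs_sub_comm _ _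

theorem norm1_zero : norm1 (0 : Site d) = 0 := by simp [norm1]

theorem latticeEntry_of_ne (v : Site d → ℝ) {x y : Site d} (h : x ≠ y) :
    latticeEntry v x y = if norm1 (x - y) = 1 then -1 else 0 := by
  classical
  simp only [latticeEntry, Pi.single_apply, if_neg h, mul_zero, add_zero, zero_sub,
    Finset.sum_neg_distrib, Finset.sum_ite_eq', mem_neighbors]
  split_ifs <;> simp

theorem latticeEntry_add (v w : Site d → ℝ) (x y : Site d) :
    latticeEntry (fun z => v z + w z) x y = latticeEntry v x y + if x = y then w x else 0 := by
  simp only [latticeEntry, Pi.single_apply]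
  split_ifs <;> ring

theorem latticeEntry_comm (v : Site d → ℝ) (x y : Site d) :
    latticeEntry v x y = latticeEntry v y x := by
  by_cases h : x = y
  · rw [h]
  · rw [latticeEntry_of_ne v h, latticeEntry_of_ne v (Ne.symm h), norm1_sub_comm]

theorem isHermitian_boxMatrix (v : Site d → ℝ) (S : Finset (Site d)) :
    (boxMatrix v S).IsHermitian := by
  ext x y
  simp [boxMatrix, latticeEntry_comm]

open Matrix in
theorem boxMatrix_mulVec_add (v v' : Site d → ℝ) (S : Finset (Site d)) (φ : S → ℝ) (i : S) :
    (boxMatrix v' S *ᵥ φ) i = (boxMatrix v S *ᵥ φ) i + (v' i - v i) * φ i := by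
  classical
  have h : ∀ j : S, boxMatrix v' S i j = boxMatrix v S i j + if i = j then (v' i - v i) else 0 := by
    intro j
    have h1 := latticeEntry_add v (fun z => v' z - v z) i j
    have h2 : (fun z => v z + (v' z - v z)) = v' := funext fun z => add_sub_cancel _ _
    rw [h2] at h1
    refine h1.trans ?_
    congr 1
    by_cases hij : i = j
    · rw [if_pos hij, if_pos (congrArg Subtype.val hij)]
    · rw [if_neg hij, if_neg fun h => hij (Subtype.ext h)]
  simp only [mulVec, dotProduct, h, add_mul, Finset.sum_add_distrib]
  simp

theorem Resonant.boxMatrix {v v' : Site d → ℝ} {S : Finset (Site d)} {E ε : ℝ}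
    (h : Resonant (boxMatrix v S) E ε) (hv : ∀ z ∈ S, |v' z - v z| ≤ ε) :
    Resonant (AlloyMSA.boxMatrix v' S) E (2 * ε) :=
  h.perturb (v := fun i => v' i - v i) (fun i => hv i i.2) fun φ i => by
    rw [boxMatrix_mulVec_add v v']; ring

open Matrix in
theorem boxMatrix_form_add_le {v v' : Site d → ℝ} {S : Finset (Site d)} {c : ℝ}
    (hv : ∀ z ∈ S, v z + c ≤ v' z) (ψ : S → ℝ) :
    ψ ⬝ᵥ (boxMatrix v S *ᵥ ψ) + c * (ψ ⬝ᵥ ψ) ≤ ψ ⬝ᵥ (boxMatrix v' S *ᵥ ψ) := by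
  simp only [dotProduct, Finset.mul_sum]
  rw [← Finset.sum_add_distrib]
  refine Finset.sum_le_sum fun i _ => ?_
  rw [boxMatrix_mulVec_add v v']
  nlinarith [hv i i.2, mul_self_nonneg (ψ i)]

theorem abs_apply_le_norm1 (k : Site d) (i : Fin d) : |(k i : ℝ)| ≤ norm1 k := by
  have : |k i| ≤ norm1 k :=
    Finset.single_le_sum (f := fun i => |k i|) (fun _ _ => abs_nonneg _) (Finset.mem_univ i)
  exact_mod_cast this

theorem norm1_add_le (x y : Site d) : norm1 (x + y) ≤ norm1 x + norm1 y := by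
  simp only [norm1, ← Finset.sum_add_distrib]
  exact Finset.sum_le_sum fun i _ => abs_add_le _ _

theorem norm1_sub_le_of_mem_cube {l : ℝ} {x z : Site d} (h : z ∈ cube l x) :
    (norm1 (z - x) : ℝ) ≤ d * l := by
  have h' := mem_cube.1 h
  simp only [norm1, Pi.sub_apply]
  push_cast
  calc ∑ i, |(z i : ℝ) - x i| ≤ ∑ _i : Fin d, l := Finset.sum_le_sum fun i _ => h' i
    _ = d * l := by simp

theorem le_norm1_of_notMem_cube {L : ℝ} {x z k : Site d} (hz : z ∈ cube L x)
    (hk : k ∉ cube (4 * L) x) : 3 * L ≤ norm1 (z - k) := by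
  rw [mem_cube] at hz hk
  push Not at hk
  obtain ⟨i, hi⟩ := hk
  have h1 := abs_apply_le_norm1 (z - k) i
  have h2 := hz i
  simp only [Pi.sub_apply, Int.cast_sub] at h1
  have h3 : |(k i : ℝ) - x i| ≤ |(z i : ℝ) - k i| + |(z i : ℝ) - x i| := by
    rw [abs_sub_comm (z i : ℝ) (k i : ℝ)]
    exact abs_sub_le _ _ _
  linarith

theorem abs_sub_sum_le_of_bound {ι : Type*} {f g : ι → ℝ} {c B : ℝ} (hf : HasSum f c)
    (Λ : Finset ι) (hg : Summable g) (hg0 : ∀ k, 0 ≤ g k) (hB : 0 ≤ B)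
    (h : ∀ k ∉ Λ, |f k| ≤ B * g k) : |c - ∑ k ∈ Λ, f k| ≤ B * ∑' k, g k := by
  classical
  have h1 : HasSum (fun k => f k - (if k ∈ Λ then f k else 0)) (c - ∑ k ∈ Λ, f k) := by
    refine hf.sub ?_
    have : HasSum (fun k => if k ∈ Λ then f k else 0) (∑ k ∈ Λ, if k ∈ Λ then f k else 0) :=
      hasSum_sum_of_ne_finset_zero fun k hk => if_neg hk
    rwa [Finset.sum_congr rfl fun k hk => if_pos hk] at this
  rw [← h1.tsum_eq, ← Real.norm_eq_abs]
  refine tsum_of_norm_bounded (hg.hasSum.mul_left B) fun k => ?_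
  by_cases hk : k ∈ Λ
  · simpa [hk] using mul_nonneg hB (hg0 k)
  · simpa [hk] using h k hk

theorem ExpDecay.summable {u : Site d → ℝ} (hu : ExpDecay u) : Summable fun k => |u k| := by
  obtain ⟨C, α, hC, hα, hb⟩ := hu
  exact Summable.of_nonneg_of_le (fun k => abs_nonneg _) hb ((summable_exp_norm1 d hα).mul_left C)

section Potential

variable {μ : Measure ℝ}

theorem exists_bound_support (hμ : Bornology.IsBounded μ.support) :
    ∃ R : ℝ, 0 < R ∧ ∀ t : μ.support, |(t : ℝ)| ≤ R := by
  obtain ⟨R, hR⟩ := hμ.exists_norm_le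
  exact ⟨max R 1, by positivity, fun t => (hR t t.2).trans (le_max_left _ _)⟩

theorem summable_potential {u : Site d → ℝ} (hu : ExpDecay u) {R : ℝ}
    (hR : ∀ t : μ.support, |(t : ℝ)| ≤ R) (ω : Config d μ) (x : Site d) :
    Summable fun k => (ω k : ℝ) * u (x - k) := by
  have h1 : Summable fun k => |u (x - k)| := (Equiv.subLeft x).summable_iff.2 hu.summable
  refine Summable.of_norm_bounded (h1.mul_left R) fun k => ?_
  rw [norm_mul]
  exact mul_le_mul_of_nonneg_right (hR (ω k)) (norm_nonneg _)

/-- Configurations that agree on the cube of radius `4L` have exponentially close potentials on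
the cube of radius `L`. -/
theorem exists_potential_sub_le {u : Site d → ℝ} (hu : ExpDecay u)
    (hμ : Bornology.IsBounded μ.support) :
    ∃ K c : ℝ, 0 < K ∧ 0 < c ∧ ∀ (L : ℝ) (x : Site d) (ω ω' : Config d μ), 0 ≤ L →
      (∀ k ∈ cube (4 * L) x, ω' k = ω k) → ∀ z ∈ cube L x,
        |potential u ω' z - potential u ω z| ≤ K * Real.exp (-c * L) := by
  obtain ⟨R, hR0, hR⟩ := exists_bound_support hμ
  have hsp := fun ω x => summable_potential (d := d) hu hR ω x
  obtain ⟨C, α, hC, hα, hb⟩ := hu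
  have hs := summable_exp_norm1 d (half_pos hα)
  refine ⟨2 * R * C * (∑' k : Site d, Real.exp (-(α / 2) * norm1 k) + 1), α, ?_, hα,
    fun L x ω ω' hL hω z hz => ?_⟩
  · have : 0 ≤ ∑' k : Site d, Real.exp (-(α / 2) * norm1 k) := tsum_nonneg fun k => by positivity
    positivity
  have h1 : HasSum (fun k => (ω' k : ℝ) * u (z - k) - (ω k : ℝ) * u (z - k))
      (potential u ω' z - potential u ω z) := (hsp ω' z).hasSum.sub (hsp ω z).hasSum
  have hg : Summable fun k : Site d => Real.exp (-(α / 2) * norm1 (z - k)) :=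
    (Equiv.subLeft z).summable_iff.2 hs
  have h2 := abs_sub_sum_le_of_bound h1 (cube (4 * L) x) hg (fun k => by positivity)
    (B := 2 * R * C * Real.exp (-α * L)) (by positivity) fun k hk => by
      -- As ‖z - k‖₁ ≥ 3L, half of the exponent already yields exp(-αL), and the other half remains
      -- summable in k.
      have h3 := le_norm1_of_notMem_cube hz hk
      rw [← sub_mul, abs_mul]
      have h4 : |(ω' k : ℝ) - ω k| ≤ 2 * R := by
        have := abs_sub (ω' k : ℝ) (ω k : ℝ)
        linarith [hR (ω' k), hR (ω k)]
      calc |(ω' k : ℝ) - ω k| * |u (z - k)|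
          ≤ 2 * R * (C * Real.exp (-α * norm1 (z - k))) := by
            gcongr
            exact hb _
        _ ≤ 2 * R * (C * Real.exp (-α * L + -(α / 2) * norm1 (z - k))) := by
            gcongr
            nlinarith
        _ = _ := by rw [Real.exp_add]; ring
  rw [Finset.sum_eq_zero fun k hk => by rw [hω k hk, sub_self], sub_zero] at h2
  refine h2.trans ?_
  have h5 : ∑' k : Site d, Real.exp (-(α / 2) * norm1 (z - k)) =
      ∑' k : Site d, Real.exp (-(α / 2) * norm1 k) :=
    (Equiv.subLeft z).tsum_eq fun k : Site d => Real.exp (-(α / 2) * norm1 k)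
  rw [h5]
  have : 0 < Real.exp (-α * L) := Real.exp_pos _
  have : 0 < 2 * R * C * Real.exp (-α * L) := by positivity
  nlinarith

end Potential

/-- On a large cube the potential can be raised by at least a fixed constant, moving only the
couplings in the cube of four times the radius, by a polynomially bounded amount. -/
theorem exists_local_direction {u : Site d → ℝ} (hu : ExpDecay u) (hu0 : u ≠ 0) :
    ∃ (c Θ L₀ : ℝ) (n : ℕ), 0 < c ∧ 0 < Θ ∧ 0 < L₀ ∧ ∀ L, L₀ ≤ L → ∀ x : Site d,
      ∃ a : Site d → ℝ, (∀ k ∈ cube (4 * L) x, |a k| ≤ (Θ * L) ^ n) ∧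
        ∀ z ∈ cube L x, c ≤ ∑ k ∈ cube (4 * L) x, a k * u (z - k) := by
  obtain ⟨θ, n, c, hc, hsum⟩ := exists_direction hu hu0
  obtain ⟨C, α, hC, hα, hb⟩ := hu
  set Θ : ℝ := (∑ i, |θ i|) + 1
  have hΘ : 0 < Θ := by positivity
  have hlin : ∀ k : Site d, |∑ i, θ i * (k i : ℝ)| ≤ Θ * norm1 k := fun k =>
    (abs_linear_le θ k).trans <| by
      have := norm1_nonneg k
      gcongr
      simp [Θ]
  let g : Site d → ℝ := fun k => (Θ * (1 + d)) ^ n * C *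
    (|Real.exp (-(α / 2) * norm1 k)| * |(norm1 k : ℝ)| ^ n)
  have hg : Summable g := by
    refine (summable_abs_mul_pow (δ := α / 4) (by positivity) ?_ n).mul_left _
    refine (summable_exp_norm1 d (by positivity : 0 < α / 4)).congr fun k => ?_
    rw [Real.abs_exp, abs_of_nonneg (by exact_mod_cast norm1_nonneg k), ← Real.exp_add]
    congr 1
    ring
  have hg0 : ∀ k, 0 ≤ g k := fun k => by positivity
  set K := ∑' k, g k
  have hK : 0 ≤ K := tsum_nonneg hg0
  have hlim : Filter.Tendsto (fun L : ℝ => Real.exp (-(α / 2) * L) * K) Filter.atTop (nhds 0) := by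
    have : Filter.Tendsto (fun L : ℝ => -(α / 2) * L) Filter.atTop Filter.atBot :=
      Filter.tendsto_id.const_mul_atTop_of_neg (by linarith)
    simpa using (Real.tendsto_exp_atBot.comp this).mul_const K
  -- From this radius on, truncating to the cube of radius 4L loses at most half of the constant.
  obtain ⟨L₀, hL₀⟩ := Filter.eventually_atTop.1
    (hlim.eventually (ge_mem_nhds (show (0 : ℝ) < |c| / 2 by positivity)))
  refine ⟨|c| / 2, Θ * (d + 1) * 4, max L₀ 1, n, by positivity, by positivity, by positivity,
    fun L hL x => ?_⟩
  have hL1 : 1 ≤ L := (le_max_right _ _).trans hL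
  have hLK := hL₀ L ((le_max_left _ _).trans hL)
  let b : Site d → ℝ := fun k => (∑ i, θ i * ((k - x) i : ℝ)) ^ n
  have hsc : (SignType.sign c : ℝ) * c = |c| := sign_mul_self c
  refine ⟨fun k => SignType.sign c * b k, fun k hk => ?_, fun z hz => ?_⟩
  · have h1 : |(SignType.sign c : ℝ)| ≤ 1 := by
      rcases lt_trichotomy c 0 with h | h | h <;> simp [h]
    rw [abs_mul]
    have h2 : |b k| ≤ (Θ * (d + 1) * 4 * L) ^ n := by
      simp only [b, abs_pow]
      gcongr
      have h3 := norm1_sub_le_of_mem_cube hk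
      refine (hlin (k - x)).trans ?_
      calc Θ * norm1 (k - x) ≤ Θ * (d * (4 * L)) := by gcongr
        _ ≤ Θ * (d + 1) * 4 * L := by
          have : 0 ≤ Θ * 4 * L := by positivity
          nlinarith
    calc _ ≤ 1 * |b k| := by gcongr
      _ ≤ _ := by rwa [one_mul]
  · have hgz : Summable fun k => g (z - k) := (Equiv.subLeft z).summable_iff.2 hg
    have h1 := abs_sub_sum_le_of_bound (hsum x z) (cube (4 * L) x) hgz (fun k => hg0 _)
      (B := Real.exp (-(α / 2) * L)) (by positivity) fun k hk => by
        have h3 := le_norm1_of_notMem_cube hz hk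
        have h4 := norm1_sub_le_of_mem_cube hz
        have h5 : (norm1 (k - x) : ℝ) ≤ norm1 (z - k) + norm1 (z - x) := by
          have := norm1_add_le (k - z) (z - x)
          rw [sub_add_sub_cancel, norm1_sub_comm k z] at this
          exact_mod_cast this
        have hN0 : (0 : ℝ) ≤ norm1 (z - k) := by exact_mod_cast norm1_nonneg _
        -- ‖z - x‖₁ ≤ dL ≤ d ‖z - k‖₁, so the weight centred at x is controlled by the distance in
        -- which u decays.
        have h6 : |∑ i, θ i * ((k - x) i : ℝ)| ≤ Θ * (1 + d) * norm1 (z - k) := by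
          refine (hlin (k - x)).trans ?_
          rw [mul_assoc]
          gcongr
          have : (d : ℝ) * L ≤ d * norm1 (z - k) := by
            gcongr
            linarith
          linarith
        simp only [g]
        rw [abs_mul, abs_pow, Real.abs_exp, abs_of_nonneg hN0]
        calc _ ≤ (Θ * (1 + d) * norm1 (z - k)) ^ n * (C * Real.exp (-α * norm1 (z - k))) := by
              gcongr
              exact hb _
          _ ≤ (Θ * (1 + d) * norm1 (z - k)) ^ n *
              (C * Real.exp (-(α / 2) * L + -(α / 2) * norm1 (z - k))) := by
              gcongr
              nlinarith
          _ = _ := by rw [Real.exp_add, mul_pow]; ring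
    have h5 : ∑' k, g (z - k) = K := (Equiv.subLeft z).tsum_eq g
    rw [h5] at h1
    have h6 : ∑ k ∈ cube (4 * L) x, (SignType.sign c : ℝ) * b k * u (z - k) =
        |c| - SignType.sign c * (c - ∑ k ∈ cube (4 * L) x, b k * u (z - k)) := by
      rw [mul_sub, hsc, sub_sub_cancel, Finset.mul_sum]
      exact Finset.sum_congr rfl fun k _ => mul_assoc _ _ _
    rw [h6]
    have h7 : |(SignType.sign c : ℝ) * (c - ∑ k ∈ cube (4 * L) x, b k * u (z - k))| ≤ |c| / 2 := by
      rw [abs_mul]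
      have h8 : |(SignType.sign c : ℝ)| ≤ 1 := by
        rcases lt_trichotomy c 0 with h | h | h <;> simp [h]
      calc _ ≤ 1 * (|c| / 2) := by
            gcongr
            exact h1.trans hLK
        _ = _ := one_mul _
    linarith [(abs_le.1 h7).2]

end AlloyMSA

/-! ### A Wegner-type estimate for two boxes -/

namespace AlloyMSA

/-- Events that quantify over energies, vectors or configurations are projections, and continuous
images of σ-compact sets are σ-compact. All such events are shown to be Borel in this way. -/
theorem measurableSet_of_isSigmaCompact {X : Type*} [TopologicalSpace X] [T2Space X]
    [MeasurableSpace X] [OpensMeasurableSpace X] {s : Set X} (h : IsSigmaCompact s) :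
    MeasurableSet s := by
  obtain ⟨K, hK, rfl⟩ := h
  exact MeasurableSet.iUnion fun n => (hK n).measurableSet

theorem isSigmaCompact_of_isClosed {X : Type*} [TopologicalSpace X] [SigmaCompactSpace X]
    {s : Set X} (h : IsClosed s) : IsSigmaCompact s :=
  isSigmaCompact_univ.of_isClosed_subset h (subset_univ s)

-- The energy ranges over a continuum, but a common resonance pins it to within ε of an eigenvalue
-- of the fixed matrix H'. Moving it there doubles the width, so the increments must be 6ε = 3 · 2ε.
open Classical in
theorem card_common_resonance_le {n₁ n₂ : Type*} [Fintype n₁] [Fintype n₂]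
    (H : ℕ → Matrix n₁ n₁ ℝ) (hH : ∀ j, (H j).IsHermitian) {H' : Matrix n₂ n₂ ℝ}
    (hH' : H'.IsHermitian) {ε : ℝ} (hε : 0 < ε)
    (hle : ∀ j ψ, ψ ⬝ᵥ ((H j).mulVec ψ) + 6 * ε * (ψ ⬝ᵥ ψ) ≤ ψ ⬝ᵥ ((H (j + 1)).mulVec ψ))
    (J : ℕ) :
    ((Finset.range J).filter fun j => ∃ E, Resonant (H j) E ε ∧ Resonant H' E ε).card ≤
      Fintype.card n₁ * Fintype.card n₂ := by
  have hsub : ((Finset.range J).filter fun j => ∃ E, Resonant (H j) E ε ∧ Resonant H' E ε) ⊆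
      Finset.univ.biUnion fun i : n₂ =>
        (Finset.range J).filter fun j => Resonant (H j) (hH'.eigenvalues i) (2 * ε) := by
    intro j hj
    obtain ⟨hj, E, h1, h2⟩ := Finset.mem_filter.1 hj
    obtain ⟨i, hi⟩ := h2.exists_eigenvalue hH' hε.le
    rw [abs_sub_comm] at hi
    exact Finset.mem_biUnion.2 ⟨i, Finset.mem_univ _, Finset.mem_filter.2 ⟨hj, h1.energy hi⟩⟩
  refine (Finset.card_le_card hsub).trans (Finset.card_biUnion_le.trans ?_)
  refine (Finset.sum_le_card_nsmul _ _ (Fintype.card n₁) fun i _ => ?_).trans ?_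
  · refine card_resonant_le H hH (by linarith) (fun j ψ => ?_) J
    have := hle j ψ
    linarith
  · simp [mul_comm]

open Classical in
/-- A set which is hit rarely by the translates in a direction `a` has small measure. -/
theorem ShiftBound.measure_le_of_card {μ : Measure ℝ} [IsProbabilityMeasure μ] {V : ℝ}
    (hV : 0 ≤ V) (h : ShiftBound μ V) {ι : Type*} [Fintype ι] (a : ι → ℝ)
    {A : Set (ι → ℝ)} (hA : MeasurableSet A) {δ : ℝ} (hδ : 0 ≤ δ) {J : ℕ} (hJ : 0 < J) {N : ℕ}
    (hN : ∀ η, ((Finset.range J).filter fun j : ℕ => η + ((j : ℝ) * δ) • a ∈ A).card ≤ N) :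
    (Measure.pi fun _ => μ).real A ≤ N / J + V * (J * δ * ∑ i, |a i|) := by
  set P : Measure (ι → ℝ) := Measure.pi fun _ => μ
  let A' : ℕ → Set (ι → ℝ) := fun j => (fun η => η + ((j : ℝ) * δ) • a) ⁻¹' A
  have hA' : ∀ j, MeasurableSet (A' j) := fun j => by
    have : Measurable fun η : ι → ℝ => η + ((j : ℝ) * δ) • a := by fun_prop
    exact this hA
  have h1 : ∀ j ∈ Finset.range J, P.real A ≤ P.real (A' j) + V * (J * δ * ∑ i, |a i|) := by
    intro j hj
    have h2 := h.pi hV (((j : ℝ) * δ) • a) hA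
    have h3 : P.real A ≤ P.real (A' j) + V * ∑ i, |(((j : ℝ) * δ) • a) i| := by
      have := ENNReal.toReal_mono (by finiteness) h2
      rw [ENNReal.toReal_add (by finiteness) (by finiteness),
        ENNReal.toReal_ofReal (by positivity)] at this
      exact this
    refine h3.trans ?_
    gcongr
    have h4 : ∑ i, |(((j : ℝ) * δ) • a) i| = j * δ * ∑ i, |a i| := by
      rw [Finset.mul_sum]
      refine Finset.sum_congr rfl fun i _ => ?_
      rw [Pi.smul_apply, smul_eq_mul, abs_mul, abs_of_nonneg (by positivity)]
    rw [h4]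
    have : (j : ℝ) ≤ J := by exact_mod_cast (Finset.mem_range.1 hj).le
    gcongr
  -- Every η lies in at most N of the translated sets; integrating the sum of indicators turns this
  -- count into a bound on measures.
  have h2 : ∑ j ∈ Finset.range J, P.real (A' j) ≤ N := by
    calc ∑ j ∈ Finset.range J, P.real (A' j)
        = ∑ j ∈ Finset.range J, ∫ η, (A' j).indicator 1 η ∂P := by
          simp_rw [integral_indicator_one (hA' _)]
      _ = ∫ η, ∑ j ∈ Finset.range J, (A' j).indicator 1 η ∂P :=
          (integral_finsetSum _ fun j _ => (integrable_const (1 : ℝ)).indicator (hA' j)).symm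
      _ ≤ ∫ _η, (N : ℝ) ∂P := by
          refine integral_mono (integrable_finsetSum _ fun j _ =>
            (integrable_const (1 : ℝ)).indicator (hA' j)) (integrable_const _) fun η => ?_
          have := hN η
          simp only [Set.indicator_apply, Pi.one_apply, Finset.sum_boole]
          exact_mod_cast this
      _ = N := by simp
  have h3 : (J : ℝ) * P.real A ≤ N + J * (V * (J * δ * ∑ i, |a i|)) := by
    have := Finset.sum_le_sum h1
    rw [Finset.sum_add_distrib] at this
    simp only [Finset.sum_const, Finset.card_range, nsmul_eq_mul] at this
    linarith
  have hJ' : (0 : ℝ) < J := by exact_mod_cast hJ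
  rw [← sub_le_iff_le_add, le_div_iff₀ hJ']
  linarith

/-- Normalising replaces the open condition φ ≠ 0 by a closed one. -/
theorem resonant_iff_normalized {n : Type*} [Fintype n] {H : Matrix n n ℝ} {E ε : ℝ} :
    Resonant H E ε ↔ ∃ φ : n → ℝ, ∑ i, φ i ^ 2 = 1 ∧
      ∑ i, ((H.mulVec φ) i - E * φ i) ^ 2 ≤ ε ^ 2 := by
  constructor
  · rintro ⟨φ, h0, h⟩
    have hpos : 0 < ∑ i, φ i ^ 2 := by
      obtain ⟨i, hi⟩ := Function.ne_iff.1 h0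
      exact Finset.sum_pos' (fun _ _ => sq_nonneg _) ⟨i, Finset.mem_univ _, by
        have : φ i ≠ 0 := hi
        positivity⟩
    set s := Real.sqrt (∑ i, φ i ^ 2)
    have hs : 0 < s := Real.sqrt_pos.2 hpos
    have hs2 : s ^ 2 = ∑ i, φ i ^ 2 := Real.sq_sqrt hpos.le
    refine ⟨s⁻¹ • φ, ?_, ?_⟩
    · simp only [Pi.smul_apply, smul_eq_mul, mul_pow, ← Finset.mul_sum, ← hs2]
      field_simp
    · have h1 : ∀ i, (H.mulVec (s⁻¹ • φ)) i - E * (s⁻¹ • φ) i =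
          s⁻¹ * ((H.mulVec φ) i - E * φ i) := fun i => by
        rw [Matrix.mulVec_smul]
        simp only [Pi.smul_apply, smul_eq_mul]
        ring
      simp only [h1, mul_pow, ← Finset.mul_sum]
      rw [← hs2] at h
      calc _ ≤ s⁻¹ ^ 2 * (ε ^ 2 * s ^ 2) := by gcongr
        _ = ε ^ 2 := by field_simp
  · rintro ⟨φ, h0, h⟩
    refine ⟨φ, ?_, by rwa [h0, mul_one]⟩
    rintro rfl
    simp at h0

theorem measurableSet_common_resonance {X : Type*} [TopologicalSpace X] [T2Space X]
    [SigmaCompactSpace X] [MeasurableSpace X] [OpensMeasurableSpace X]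
    {n₁ n₂ : Type*} [Fintype n₁] [Fintype n₂] {M₁ : X → Matrix n₁ n₁ ℝ}
    {M₂ : X → Matrix n₂ n₂ ℝ} (h₁ : Continuous M₁) (h₂ : Continuous M₂) (ε : ℝ) :
    MeasurableSet {η | ∃ E, Resonant (M₁ η) E ε ∧ Resonant (M₂ η) E ε} := by
  let F : Set (X × ℝ × (n₁ → ℝ) × (n₂ → ℝ)) := {p |
    (∑ i, p.2.2.1 i ^ 2 = 1 ∧
      ∑ i, (((M₁ p.1).mulVec p.2.2.1) i - p.2.1 * p.2.2.1 i) ^ 2 ≤ ε ^ 2) ∧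
    (∑ i, p.2.2.2 i ^ 2 = 1 ∧
      ∑ i, (((M₂ p.1).mulVec p.2.2.2) i - p.2.1 * p.2.2.2 i) ^ 2 ≤ ε ^ 2)}
  have c₁ : Continuous fun p : X × ℝ × (n₁ → ℝ) × (n₂ → ℝ) => (M₁ p.1).mulVec p.2.2.1 :=
    (h₁.comp continuous_fst).matrix_mulVec (by fun_prop)
  have c₂ : Continuous fun p : X × ℝ × (n₁ → ℝ) × (n₂ → ℝ) => (M₂ p.1).mulVec p.2.2.2 :=
    (h₂.comp continuous_fst).matrix_mulVec (by fun_prop)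
  have hF : IsClosed F := by
    refine IsClosed.and (IsClosed.and ?_ ?_) (IsClosed.and ?_ ?_)
    · exact isClosed_eq (by fun_prop) continuous_const
    · exact isClosed_le (by fun_prop) continuous_const
    · exact isClosed_eq (by fun_prop) continuous_const
    · exact isClosed_le (by fun_prop) continuous_const
  have : {η | ∃ E, Resonant (M₁ η) E ε ∧ Resonant (M₂ η) E ε} = Prod.fst '' F := by
    ext η
    simp only [resonant_iff_normalized, mem_ofPred_eq, mem_image, Prod.exists, F]
    constructor
    · rintro ⟨E, ⟨φ, hφ⟩, φ', hφ'⟩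
      exact ⟨η, E, φ, φ', ⟨hφ, hφ'⟩, rfl⟩
    · rintro ⟨η', E, φ, φ', ⟨hφ, hφ'⟩, rfl⟩
      exact ⟨E, ⟨φ, hφ⟩, φ', hφ'⟩
  rw [this]
  exact measurableSet_of_isSigmaCompact ((isSigmaCompact_of_isClosed hF).image continuous_fst)

end AlloyMSA

/-! ### Finitely many real couplings and the Wegner estimate for the random operator. -/

namespace AlloyMSA

variable {d : ℕ} {μ : Measure ℝ}

theorem card_cube_le {l : ℝ} (hl : 0 ≤ l) (x : Site d) :
    ((cube l x).card : ℝ) ≤ (2 * l + 1) ^ d := by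
  rw [cube, Fintype.card_piFinset]
  push_cast
  calc ∏ i, ((Finset.Icc ⌈(x i : ℝ) - l⌉ ⌊(x i : ℝ) + l⌋).card : ℝ)
      ≤ ∏ _i : Fin d, (2 * l + 1) := by
        refine Finset.prod_le_prod (fun i _ => by positivity) fun i _ => ?_
        rw [Int.card_Icc]
        have h1 := Int.floor_le ((x i : ℝ) + l)
        have h2 := Int.le_ceil ((x i : ℝ) - l)
        have h3 : ((⌊(x i : ℝ) + l⌋ + 1 - ⌈(x i : ℝ) - l⌉ : ℤ) : ℝ) ≤ 2 * l + 1 := by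
          push_cast
          linarith
        rcases le_total 0 (⌊(x i : ℝ) + l⌋ + 1 - ⌈(x i : ℝ) - l⌉) with h | h
        · rw [← Int.toNat_of_nonneg h] at h3
          exact_mod_cast h3
        · rw [Int.toNat_of_nonpos h]
          simp
          linarith
    _ = _ := by simp

theorem map_siteMeasure (μ : Measure ℝ) :
    (siteMeasure μ).map (Subtype.val : μ.support → ℝ) = μ := by
  rw [siteMeasure, (MeasurableEmbedding.subtype_coe
    Measure.isClosed_support.measurableSet).map_comap, Subtype.range_coe]
  exact Measure.restrict_eq_self_of_ae_mem Measure.support_mem_ae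

theorem map_prob_restrict [IsProbabilityMeasure μ] (T : Finset (Site d)) :
    (prob d μ).map (fun ω (k : T) => (ω k : ℝ)) = Measure.pi fun _ => μ := by
  have h1 : (fun (ω : Config d μ) (k : T) => (ω k : ℝ)) =
      (fun (η : T → μ.support) (k : T) => (η k : ℝ)) ∘ T.restrict := rfl
  have h2 : Measurable fun (η : T → μ.support) (k : T) => (η k : ℝ) := by fun_prop
  rw [h1]
  refine (Measure.map_map h2 (Finset.measurable_restrict T)).symm.trans ?_
  rw [prob, Measure.infinitePi_map_restrict]
  have : ∀ _ : T, SigmaFinite ((siteMeasure μ).map (Subtype.val : μ.support → ℝ)) := fun _ => by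
    rw [map_siteMeasure]; infer_instance
  rw [Measure.pi_map_pi (f := fun _ : T => (Subtype.val : μ.support → ℝ))
    fun _ => measurable_subtype_coe.aemeasurable]
  simp_rw [map_siteMeasure]

open Classical in
theorem potential_piecewise {u : Site d → ℝ} (hu : ExpDecay u)
    (hμ : Bornology.IsBounded μ.support) (Λ : Finset (Site d)) (ω ω₀ : Config d μ) (z : Site d) :
    potential u (Λ.piecewise ω ω₀) z =
      potential u ω₀ z + ∑ k ∈ Λ, ((ω k : ℝ) - ω₀ k) * u (z - k) := by
  obtain ⟨R, hR0, hR⟩ := exists_bound_support hμ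
  have h1 := (summable_potential hu hR ω₀ z).hasSum
  have h2 : HasSum (fun k => if k ∈ Λ then ((ω k : ℝ) - ω₀ k) * u (z - k) else 0)
      (∑ k ∈ Λ, if k ∈ Λ then ((ω k : ℝ) - ω₀ k) * u (z - k) else 0) :=
    hasSum_sum_of_ne_finset_zero fun k hk => if_neg hk
  rw [Finset.sum_congr rfl fun k hk => if_pos hk] at h2
  have h3 := h1.add h2
  refine (HasSum.tsum_eq ?_ : potential u (Λ.piecewise ω ω₀) z = _)
  refine h3.congr_fun fun k => ?_
  by_cases hk : k ∈ Λ
  · simp [hk]; ring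
  · simp [hk]

open Classical in
/-- The potential with background `v₀` and couplings `η k - ω₀ k` at the sites `k ∈ Λ`. -/
noncomputable def frozenPotential (u v₀ ω₀ : Site d → ℝ) (T Λ : Finset (Site d)) (η : T → ℝ)
    (z : Site d) : ℝ :=
  v₀ z + ∑ k : T, if (k : Site d) ∈ Λ then (η k - ω₀ k) * u (z - k) else 0

open Classical in
theorem sum_coe_ite_mem {T Λ : Finset (Site d)} (h : Λ ⊆ T) (f : Site d → ℝ) :
    (∑ k : T, if (k : Site d) ∈ Λ then f k else 0) = ∑ k ∈ Λ, f k := by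
  rw [Finset.sum_coe_sort T fun k => if k ∈ Λ then f k else 0, Finset.sum_ite_mem,
    Finset.inter_eq_right.2 h]

open Classical in
theorem frozenPotential_coe {u : Site d → ℝ} (hu : ExpDecay u)
    (hμ : Bornology.IsBounded μ.support) {T Λ : Finset (Site d)} (hΛ : Λ ⊆ T)
    (ω ω₀ : Config d μ) :
    frozenPotential u (potential u ω₀) (fun k => ω₀ k) T Λ (fun k : T => (ω k : ℝ)) =
      potential u (Λ.piecewise ω ω₀) := by
  ext z
  rw [potential_piecewise hu hμ, frozenPotential,
    sum_coe_ite_mem hΛ fun k => ((ω k : ℝ) - ω₀ k) * u (z - k)]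

theorem continuous_boxMatrix_frozenPotential (u v₀ ω₀ : Site d → ℝ) (T Λ S : Finset (Site d)) :
    Continuous fun η : T → ℝ => boxMatrix (frozenPotential u v₀ ω₀ T Λ η) S := by
  classical
  refine continuous_matrix fun i j => ?_
  have hv : Continuous fun η : T → ℝ => frozenPotential u v₀ ω₀ T Λ η i := by
    refine continuous_const.add (continuous_finsetSum _ fun k _ => ?_)
    split_ifs
    · fun_prop
    · fun_prop
  simp only [boxMatrix, Matrix.of_apply, latticeEntry]
  fun_prop

open Classical in
theorem frozenPotential_add_smul (u v₀ ω₀ : Site d → ℝ) {T Λ : Finset (Site d)} (hΛ : Λ ⊆ T)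
    (a : Site d → ℝ) (η : T → ℝ) (s : ℝ) (z : Site d) :
    frozenPotential u v₀ ω₀ T Λ (η + s • fun k : T => if (k : Site d) ∈ Λ then a k else 0) z =
      frozenPotential u v₀ ω₀ T Λ η z + s * ∑ k ∈ Λ, a k * u (z - k) := by
  rw [← sum_coe_ite_mem hΛ fun k => a k * u (z - k), Finset.mul_sum, frozenPotential,
    frozenPotential, add_assoc, ← Finset.sum_add_distrib]
  congr 1
  refine Finset.sum_congr rfl fun k _ => ?_
  by_cases hk : (k : Site d) ∈ Λ
  · simp [hk]; ring
  · simp [hk]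

-- Both boxes are read off the same η, but moving the couplings around the first leaves the second
-- unchanged. The second thus supplies the fixed matrix in `card_common_resonance_le`.
open Classical in
theorem frozenPotential_add_smul_of_disjoint (u v₀ ω₀ : Site d → ℝ) {T Λ Λ' : Finset (Site d)}
    (hdisj : Disjoint Λ Λ') (a : Site d → ℝ) (η : T → ℝ) (s : ℝ) :
    frozenPotential u v₀ ω₀ T Λ' (η + s • fun k : T => if (k : Site d) ∈ Λ then a k else 0) =
      frozenPotential u v₀ ω₀ T Λ' η := by
  ext z
  rw [frozenPotential, frozenPotential]
  congr 1
  refine Finset.sum_congr rfl fun k _ => ?_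
  by_cases hk : (k : Site d) ∈ Λ'
  · have : (k : Site d) ∉ Λ := fun h => Finset.disjoint_left.1 hdisj h hk
    simp [hk, this]
  · simp [hk]

open Classical in
theorem measure_common_resonance_le [IsProbabilityMeasure μ] {V : ℝ} (hV : 0 ≤ V)
    (hsh : ShiftBound μ V) (u v₀ ω₀ : Site d → ℝ) {T Λ Λ' : Finset (Site d)} (hΛ : Λ ⊆ T)
    (hdisj : Disjoint Λ Λ') (S S' : Finset (Site d)) (a : Site d → ℝ) {c ε δ : ℝ} (hε : 0 < ε)
    (hδ : 0 ≤ δ) (hcδ : 6 * ε ≤ δ * c) (ha : ∀ z ∈ S, c ≤ ∑ k ∈ Λ, a k * u (z - k))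
    {J : ℕ} (hJ : 0 < J) :
    (Measure.pi fun _ : T => μ).real
      {η | ∃ E, Resonant (boxMatrix (frozenPotential u v₀ ω₀ T Λ η) S) E ε ∧
        Resonant (boxMatrix (frozenPotential u v₀ ω₀ T Λ' η) S') E ε} ≤
      (S.card * S'.card : ℕ) / J + V * (J * δ * ∑ k ∈ Λ, |a k|) := by
  have hA := measurableSet_common_resonance
    (continuous_boxMatrix_frozenPotential u v₀ ω₀ T Λ S)
    (continuous_boxMatrix_frozenPotential u v₀ ω₀ T Λ' S') ε
  have hsum : ∑ k : T, |if (k : Site d) ∈ Λ then a k else 0| = ∑ k ∈ Λ, |a k| := by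
    rw [← sum_coe_ite_mem hΛ fun k => |a k|]
    refine Finset.sum_congr rfl fun k _ => ?_
    split_ifs <;> simp
  rw [← hsum]
  refine hsh.measure_le_of_card hV _ hA hδ hJ fun η => ?_
  have hcount := card_common_resonance_le
    (fun j : ℕ => boxMatrix (frozenPotential u v₀ ω₀ T Λ
      (η + ((j : ℝ) * δ) • fun k : T => if (k : Site d) ∈ Λ then a k else 0)) S)
    (fun j => isHermitian_boxMatrix _ _)
    (isHermitian_boxMatrix (frozenPotential u v₀ ω₀ T Λ' η) S') hε
    (fun j ψ => boxMatrix_form_add_le (fun z hz => by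
      rw [frozenPotential_add_smul u v₀ ω₀ hΛ, frozenPotential_add_smul u v₀ ω₀ hΛ]
      have h2 : 6 * ε ≤ δ * ∑ k ∈ Λ, a k * u (z - k) :=
        hcδ.trans (mul_le_mul_of_nonneg_left (ha z hz) hδ)
      push_cast
      linarith) ψ) J
  rw [Fintype.card_coe, Fintype.card_coe] at hcount
  refine le_trans (Finset.card_le_card fun j hj => ?_) hcount
  rw [Finset.mem_filter] at hj ⊢
  obtain ⟨hj, E, h1, h2⟩ := hj
  rw [frozenPotential_add_smul_of_disjoint u v₀ ω₀ hdisj] at h2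
  exact ⟨hj, E, h1, h2⟩

open Classical in
/-- The probability that restrictions to two distant boxes, with the couplings frozen outside of
larger cubes, share a resonance. -/
theorem wegner_two_boxes [IsProbabilityMeasure μ] {u : Site d → ℝ} (hu : ExpDecay u) (hu0 : u ≠ 0)
    (hμ : Bornology.IsBounded μ.support) {V : ℝ} (hV : 0 ≤ V) (hsh : ShiftBound μ V) :
    ∃ (D L₀ : ℝ) (p : ℕ), 0 < D ∧ 1 ≤ L₀ ∧ ∀ L, L₀ ≤ L → ∀ ε : ℝ, 0 < ε → ε ≤ 1 →
      ∀ x y : Site d, Disjoint (cube (4 * L) x) (cube (4 * L) y) →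
      ∀ S₁ ⊆ cube L x, ∀ S₂ ⊆ cube L y, ∀ ω₀ : Config d μ,
      (prob d μ).real {ω | ∃ E,
        Resonant (boxHamiltonian u ((cube (4 * L) x).piecewise ω ω₀) S₁) E ε ∧
        Resonant (boxHamiltonian u ((cube (4 * L) y).piecewise ω ω₀) S₂) E ε} ≤
      D * L ^ p * √ε := by
  obtain ⟨c, Θ, L₀, n, hc, hΘ, hL₀, hdir⟩ := exists_local_direction hu hu0
  refine ⟨3 ^ (2 * d) + V * (12 / c * 9 ^ d * Θ ^ n), max L₀ 1, 2 * d + n, by positivity,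
    le_max_right _ _, fun L hL ε hε hε1 x y hdisj S₁ hS₁ S₂ hS₂ ω₀ => ?_⟩
  have hL1 : 1 ≤ L := (le_max_right _ _).trans hL
  obtain ⟨a, ha, hac⟩ := hdir L ((le_max_left _ _).trans hL) x
  set Λ₁ := cube (4 * L) x
  set Λ₂ := cube (4 * L) y
  set T := Λ₁ ∪ Λ₂
  have hmap : Measurable fun (ω : Config d μ) (k : T) => (ω k : ℝ) := by fun_prop
  let F : Finset (Site d) → (T → ℝ) → Site d → ℝ :=
    frozenPotential u (potential u ω₀) (fun k => ω₀ k) T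
  let A : Set (T → ℝ) := {η | ∃ E, Resonant (boxMatrix (F Λ₁ η) S₁) E ε ∧
    Resonant (boxMatrix (F Λ₂ η) S₂) E ε}
  have hA : MeasurableSet A := measurableSet_common_resonance
    (continuous_boxMatrix_frozenPotential _ _ _ T Λ₁ S₁)
    (continuous_boxMatrix_frozenPotential _ _ _ T Λ₂ S₂) ε
  have hevent : {ω : Config d μ | ∃ E,
        Resonant (boxHamiltonian u (Λ₁.piecewise ω ω₀) S₁) E ε ∧
        Resonant (boxHamiltonian u (Λ₂.piecewise ω ω₀) S₂) E ε} =
      (fun (ω : Config d μ) (k : T) => (ω k : ℝ)) ⁻¹' A := by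
    ext ω
    simp only [mem_preimage, mem_ofPred_eq, A, F, boxHamiltonian_eq]
    rw [frozenPotential_coe hu hμ Finset.subset_union_left,
      frozenPotential_coe hu hμ Finset.subset_union_right]
  rw [hevent, ← map_measureReal_apply hmap hA, map_prob_restrict]
  -- One step in the direction `a` raises the potential by at least δ c = 6ε, the spacing required
  -- for the count.
  set δ := 6 * ε / c
  have hδ : 0 < δ := by positivity
  -- This J balances the count term, of order 1/J, against the translation cost, of order Jε; up to
  -- powers of L both become √ε.
  set J := ⌈(√ε)⁻¹⌉₊
  have hsq : 0 < √ε := Real.sqrt_pos.2 hε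
  have hsq1 : √ε ≤ 1 := Real.sqrt_le_one.2 hε1
  have hinv : 1 ≤ (√ε)⁻¹ := (one_le_inv₀ hsq).2 hsq1
  have hJ : (√ε)⁻¹ ≤ J := Nat.le_ceil _
  have hJ2 : (J : ℝ) ≤ 2 * (√ε)⁻¹ := by
    have := (Nat.ceil_lt_add_one (by positivity : 0 ≤ (√ε)⁻¹)).le
    linarith
  have hJ0 : 0 < J := Nat.ceil_pos.2 (by positivity)
  have hmain := measure_common_resonance_le hV hsh u (potential u ω₀) (fun k => ω₀ k)
    (T := T) Finset.subset_union_left hdisj S₁ S₂ a hε hδ.le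
    (by simp only [δ]; rw [div_mul_cancel₀ _ hc.ne']) (fun z hz => hac z (hS₁ hz)) hJ0
  have hbsum : ∑ k ∈ Λ₁, |a k| ≤ (9 * L) ^ d * (Θ * L) ^ n := by
    refine (Finset.sum_le_card_nsmul _ _ _ ha).trans ?_
    rw [nsmul_eq_mul]
    gcongr
    refine (card_cube_le (by positivity) x).trans ?_
    gcongr
    linarith
  have hcard : ∀ (S : Finset (Site d)) (w : Site d), S ⊆ cube L w →
      (S.card : ℝ) ≤ (3 * L) ^ d := by
    intro S w hS
    have h1 : (S.card : ℝ) ≤ (cube L w).card := by exact_mod_cast Finset.card_le_card hS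
    refine h1.trans ((card_cube_le (by positivity) w).trans ?_)
    gcongr
    linarith
  have h1 : ((S₁.card * S₂.card : ℕ) : ℝ) / J ≤ 3 ^ (2 * d) * L ^ (2 * d + n) * √ε := by
    have h2 : ((S₁.card * S₂.card : ℕ) : ℝ) ≤ (3 * L) ^ d * (3 * L) ^ d := by
      push_cast
      exact mul_le_mul (hcard S₁ x hS₁) (hcard S₂ y hS₂) (by positivity) (by positivity)
    calc _ ≤ (3 * L) ^ d * (3 * L) ^ d / (√ε)⁻¹ := by gcongr
      _ = 3 ^ (2 * d) * L ^ (2 * d) * √ε := by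
        rw [div_inv_eq_mul, ← pow_add, ← two_mul, mul_pow]
      _ ≤ _ := by
        gcongr
        omega
  have h2 : J * δ * ∑ k ∈ Λ₁, |a k| ≤ 12 / c * 9 ^ d * Θ ^ n * L ^ (2 * d + n) * √ε := by
    calc J * δ * ∑ k ∈ Λ₁, |a k| ≤ (2 * (√ε)⁻¹) * δ * ((9 * L) ^ d * (Θ * L) ^ n) := by gcongr
      _ = 12 / c * 9 ^ d * Θ ^ n * L ^ (d + n) * ((√ε)⁻¹ * ε) := by
        simp only [δ]
        rw [mul_pow, mul_pow, pow_add]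
        ring
      _ = 12 / c * 9 ^ d * Θ ^ n * L ^ (d + n) * √ε := by
        congr 1
        rw [inv_mul_eq_div, Real.div_sqrt]
      _ ≤ _ := by
        gcongr
        omega
  calc _ ≤ _ := hmain
    _ ≤ 3 ^ (2 * d) * L ^ (2 * d + n) * √ε +
        V * (12 / c * 9 ^ d * Θ ^ n * L ^ (2 * d + n) * √ε) := by gcongr
    _ = _ := by ring

open Classical in
/-- The probability that two distant boxes share a resonance for some modifications of the
configuration outside of larger cubes. -/
theorem exists_uniform_wegner [IsProbabilityMeasure μ] {u : Site d → ℝ} (hu : ExpDecay u)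
    (hu0 : u ≠ 0) (hμ : Bornology.IsBounded μ.support) {V : ℝ} (hV : 0 ≤ V)
    (hsh : ShiftBound μ V) :
    ∃ (D K c L₀ : ℝ) (p : ℕ), 0 < D ∧ 0 < K ∧ 0 < c ∧ 1 ≤ L₀ ∧ ∀ L, L₀ ≤ L → ∀ ε : ℝ,
      K * Real.exp (-c * L) ≤ ε → ε ≤ 1 / 2 →
      ∀ x y : Site d, Disjoint (cube (4 * L) x) (cube (4 * L) y) →
      ∀ S₁ ⊆ cube L x, ∀ S₂ ⊆ cube L y,
      (prob d μ).real {ω | ∃ E,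
        (∃ ω' : Config d μ, (∀ k ∈ cube (4 * L) x, ω' k = ω k) ∧
          Resonant (boxHamiltonian u ω' S₁) E ε) ∧
        (∃ ω' : Config d μ, (∀ k ∈ cube (4 * L) y, ω' k = ω k) ∧
          Resonant (boxHamiltonian u ω' S₂) E ε)} ≤
      D * L ^ p * √ε := by
  obtain ⟨D, L₀, p, hD, hL₀, h⟩ := wegner_two_boxes hu hu0 hμ hV hsh
  obtain ⟨K, c, hK, hc, hpot⟩ := exists_potential_sub_le (d := d) hu hμ
  refine ⟨D * √2, K, c, L₀, p, by positivity, hK, hc, hL₀,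
    fun L hL ε hε hε1 x y hdisj S₁ hS₁ S₂ hS₂ => ?_⟩
  have hε0 : 0 < ε := lt_of_lt_of_le (by positivity) hε
  have : Nonempty (Config d μ) := (prob d μ).nonempty_of_neZero
  obtain ⟨ω₀⟩ := this
  -- Configurations agreeing on the cube of radius 4L have potentials within ε of each other on the
  -- cube of radius L. Freezing the outside at ω₀ removes the quantifier over ω' at the price of
  -- doubling ε.
  have key : ∀ (w : Site d) (S : Finset (Site d)), S ⊆ cube L w → ∀ (ω ω' : Config d μ) (E : ℝ),
      (∀ k ∈ cube (4 * L) w, ω' k = ω k) → Resonant (boxHamiltonian u ω' S) E ε →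
      Resonant (boxHamiltonian u ((cube (4 * L) w).piecewise ω ω₀) S) E (2 * ε) := by
    intro w S hS ω ω' E hω hr
    rw [boxHamiltonian_eq] at hr ⊢
    refine hr.boxMatrix fun z hz => ?_
    refine (hpot L w ω' _ (by linarith) (fun k hk => ?_) z (hS hz)).trans hε
    rw [Finset.piecewise_eq_of_mem _ _ _ hk, hω k hk]
  refine le_trans (measureReal_mono (s₂ := {ω | ∃ E,
        Resonant (boxHamiltonian u ((cube (4 * L) x).piecewise ω ω₀) S₁) E (2 * ε) ∧
        Resonant (boxHamiltonian u ((cube (4 * L) y).piecewise ω ω₀) S₂) E (2 * ε)}) ?_) ?_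
  · rintro ω ⟨E, ⟨ω', h1, h2⟩, ω'', h3, h4⟩
    exact ⟨E, key x S₁ hS₁ ω ω' E h1 h2, key y S₂ hS₂ ω ω'' E h3 h4⟩
  · refine (h L hL (2 * ε) (by linarith) (by linarith) x y hdisj S₁ hS₁ S₂ hS₂ ω₀).trans ?_
    rw [Real.sqrt_mul (by norm_num)]
    exact le_of_eq (by ring)

end AlloyMSA

/-! ### The geometric resolvent inequality -/

namespace AlloyMSA

variable {d : ℕ} {μ : Measure ℝ}

theorem norm1_eq_one_iff {k : Site d} :
    norm1 k = 1 ↔ ∃ (i : Fin d) (s : ℤˣ), k = Pi.single i (s : ℤ) := by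
  constructor
  · intro h
    have hex : ∃ i, k i ≠ 0 := by
      by_contra! hcon
      have : k = 0 := funext hcon
      rw [this, norm1_zero] at h
      exact zero_ne_one h
    obtain ⟨i, hi⟩ := hex
    have hsplit : |k i| + ∑ j ∈ Finset.univ.erase i, |k j| = 1 := by
      exact (Finset.add_sum_erase _ (fun j => |k j|) (Finset.mem_univ i)).trans h
    have h1 : 1 ≤ |k i| := Int.one_le_abs hi
    have h2 : 0 ≤ ∑ j ∈ Finset.univ.erase i, |k j| := Finset.sum_nonneg fun _ _ => abs_nonneg _
    have h3 : ∑ j ∈ Finset.univ.erase i, |k j| = 0 := by omega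
    have h4 : |k i| = 1 := by omega
    have h5 : IsUnit (k i) := Int.isUnit_iff_abs_eq.2 h4
    refine ⟨i, h5.unit, funext fun j => ?_⟩
    by_cases hj : j = i
    · subst hj; simp
    · rw [Pi.single_eq_of_ne hj]
      have := (Finset.sum_eq_zero_iff_of_nonneg fun j _ => abs_nonneg (k j)).1 h3 j
        (Finset.mem_erase.2 ⟨hj, Finset.mem_univ _⟩)
      exact abs_eq_zero.1 this
  · rintro ⟨i, s, rfl⟩
    rw [norm1, Finset.sum_eq_single i]
    · rcases Int.units_eq_one_or s with rfl | rfl <;> simp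
    · intro j _ hj
      simp [Pi.single_eq_of_ne hj]
    · simp

theorem card_neighbors (x : Site d) : (neighbors x).card = 2 * d := by
  classical
  have h : neighbors x = (Finset.univ : Finset (Fin d × ℤˣ)).image
      fun p => x - Pi.single p.1 (p.2 : ℤ) := by
    ext y
    rw [mem_neighbors, norm1_eq_one_iff]
    simp only [Finset.mem_image, Finset.mem_univ, true_and, Prod.exists]
    refine exists_congr fun i => exists_congr fun s => ?_
    constructor
    · intro h; rw [← h]; abel
    · rintro rfl; abel
  rw [h, Finset.card_image_of_injective]
  · simp [mul_comm]
  · rintro ⟨i, s⟩ ⟨j, t⟩ hst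
    have hst' : (Pi.single i (s : ℤ) : Site d) = Pi.single j (t : ℤ) := sub_right_injective hst
    have hij : i = j := by
      by_contra hne
      have := congrFun hst' i
      simp [hne] at this
    subst hij
    have := congrFun hst' i
    simp only [Pi.single_eq_same] at this
    rw [Units.ext this]

theorem mem_innerBoundary_of_neighbor {S : Finset (Site d)} {q q' : Site d} (hq : q ∈ S)
    (hq' : q' ∉ S) (h : norm1 (q - q') = 1) : q ∈ innerBoundary S := by
  classical
  refine Finset.mem_filter.2 ⟨hq, ?_⟩
  rw [← card_neighbors q]
  refine Finset.card_lt_card ⟨fun j hj => mem_neighbors.2 (Finset.mem_filter.1 hj).2, fun hcon => ?_⟩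
  exact hq' (Finset.mem_filter.1 (hcon (mem_neighbors.2 h))).1

theorem mem_cube_add_one {l : ℝ} {x q q' : Site d} (hq : q ∈ cube l x) (h : norm1 (q - q') = 1) :
    q' ∈ cube (l + 1) x := by
  rw [mem_cube] at hq ⊢
  intro i
  have h1 := abs_apply_le_norm1 (q - q') i
  rw [h] at h1
  simp only [Pi.sub_apply, Int.cast_sub, Int.cast_one] at h1
  have h2 := abs_sub_le (q' i : ℝ) (q i) (x i)
  rw [abs_sub_comm (q' i : ℝ) (q i)] at h2
  linarith [hq i]

theorem cube_subset_cube {l l' : ℝ} (h : l ≤ l') (x : Site d) : cube l x ⊆ cube l' x :=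
  fun _ hk => mem_cube.2 fun i => (mem_cube.1 hk i).trans h

theorem mem_cube_trans {l l' : ℝ} {x z k : Site d} (hk : k ∈ cube l z) (hz : z ∈ cube l' x) :
    k ∈ cube (l' + l) x := by
  rw [mem_cube] at *
  intro i
  linarith [abs_sub_le (k i : ℝ) (z i) (x i), hk i, hz i]

/-- This keeps w outside all subcubes of radius at most L - 1, as the resolvent identity requires.
-/
theorem notMem_cube_of_mem_innerBoundary {L : ℝ} {x w : Site d}
    (hw : w ∈ innerBoundary (cube L x)) : w ∉ cube (L - 1) x := by
  classical
  intro hcon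
  obtain ⟨_, h⟩ := Finset.mem_filter.1 hw
  refine absurd h (not_lt.2 ?_)
  rw [← card_neighbors w]
  refine Finset.card_le_card fun j hj => Finset.mem_filter.2 ⟨?_, mem_neighbors.1 hj⟩
  have := mem_cube_add_one hcon (mem_neighbors.1 hj)
  rwa [sub_add_cancel] at this

theorem cube_floor {L : ℝ} (hL : 0 ≤ L) (x : Site d) : cube ((⌊L⌋₊ : ℕ) : ℝ) x = cube L x := by
  refine Finset.Subset.antisymm (cube_subset_cube (Nat.floor_le hL) x) fun k hk => ?_
  rw [mem_cube] at *
  intro i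
  have h1 := hk i
  have h2 : |(k i : ℝ) - x i| = ((k i - x i).natAbs : ℕ) := by
    rw [Nat.cast_natAbs]
    push_cast
    rfl
  rw [h2] at h1 ⊢
  exact_mod_cast Nat.le_floor h1

theorem mem_cube_iff_norm {l : ℝ} (hl : 0 ≤ l) {x z : Site d} : z ∈ cube l x ↔ ‖z - x‖ ≤ l := by
  rw [mem_cube, pi_norm_le_iff_of_nonneg hl]
  refine forall_congr' fun i => ?_
  rw [Pi.sub_apply, Int.norm_eq_abs]
  push_cast
  rfl

/-- The resolvent entries of the restriction of `h₀ + v` to `S`. -/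
noncomputable def boxGreen (v : Site d → ℝ) (S : Finset (Site d)) (E : ℝ) (x y : Site d) : ℝ :=
  if h : x ∈ S ∧ y ∈ S then
    (boxMatrix v S - E • (1 : Matrix S S ℝ))⁻¹ ⟨x, h.1⟩ ⟨y, h.2⟩
  else 0

theorem green_eq (u : Site d → ℝ) (ω : Config d μ) (S : Finset (Site d)) (E : ℝ) (x y : Site d) :
    green u ω S E x y = boxGreen (potential u ω) S E x y := rfl

open Classical in
/-- The geometric resolvent identity. -/
theorem boxGreen_eq_sum (v : Site d → ℝ) {S Λ : Finset (Site d)} (hS : S ⊆ Λ) {E : ℝ}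
    (hSE : IsUnit (boxMatrix v S - E • (1 : Matrix S S ℝ)).det)
    (hΛE : IsUnit (boxMatrix v Λ - E • (1 : Matrix Λ Λ ℝ)).det) {z w : Site d} (hz : z ∈ S)
    (hw : w ∈ Λ) (hwS : w ∉ S) :
    boxGreen v Λ E z w = ∑ q ∈ S, boxGreen v S E z q *
      ∑ q' ∈ (Λ \ S).filter (fun q' => norm1 (q - q') = 1), boxGreen v Λ E q' w := by
  set AS := boxMatrix v S - E • (1 : Matrix S S ℝ) with hAS
  set AΛ := boxMatrix v Λ - E • (1 : Matrix Λ Λ ℝ) with hAΛ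
  let f : Site d → ℝ := fun q => boxGreen v Λ E q w
  have hf : ∀ q : Λ, f q = AΛ⁻¹ q ⟨w, hw⟩ := fun q => by
    simp only [f, boxGreen, dif_pos (⟨q.2, hw⟩ : (q : Site d) ∈ Λ ∧ w ∈ Λ)]
    rfl
  let B : Site d → Site d → ℝ := fun q q' => latticeEntry v q q' - if q = q' then E else 0
  have hBΛ : ∀ q q' : Λ, AΛ q q' = B q q' := fun q q' => by
    simp only [hAΛ, B, boxMatrix, Matrix.sub_apply, Matrix.of_apply, Matrix.smul_apply,
      Matrix.one_apply, smul_eq_mul, Subtype.ext_iff, mul_ite, mul_one, mul_zero]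
  have hBS : ∀ q q' : S, AS q q' = B q q' := fun q q' => by
    simp only [hAS, B, boxMatrix, Matrix.sub_apply, Matrix.of_apply, Matrix.smul_apply,
      Matrix.one_apply, smul_eq_mul, Subtype.ext_iff, mul_ite, mul_one, mul_zero]
  have h1 : ∀ q ∈ S, ∑ q' ∈ Λ, B q q' * f q' = 0 := by
    intro q hq
    have h2 := congrFun (congrFun (Matrix.mul_nonsing_inv AΛ hΛE) ⟨q, hS hq⟩) ⟨w, hw⟩
    have hne : (⟨q, hS hq⟩ : Λ) ≠ ⟨w, hw⟩ := fun h => hwS ((Subtype.mk.inj h) ▸ hq)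
    rw [Matrix.mul_apply, Matrix.one_apply_ne hne] at h2
    rw [← h2, ← Finset.sum_coe_sort Λ fun q' => B q q' * f q']
    exact Finset.sum_congr rfl fun q' _ => by rw [hBΛ, hf]
  -- Since w ∉ S, the Green's function of Λ solves the homogeneous equation on S. Its hopping terms
  -- into Λ \ S, with entries -1, form the source g of an equation on S, which is then inverted.
  let g : Site d → ℝ := fun q =>
    ∑ q' ∈ (Λ \ S).filter (fun q' => norm1 (q - q') = 1), boxGreen v Λ E q' w
  have h2 : ∀ q ∈ S, ∑ q' ∈ S, B q q' * f q' = g q := by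
    intro q hq
    have h3 := h1 q hq
    rw [← Finset.sum_sdiff hS, add_comm, add_eq_zero_iff_eq_neg] at h3
    simp only [g]
    rw [h3, ← Finset.sum_neg_distrib, Finset.sum_filter]
    refine Finset.sum_congr rfl fun q' hq' => ?_
    have hne : q ≠ q' := fun h => (Finset.mem_sdiff.1 hq').2 (h ▸ hq)
    simp only [B, latticeEntry_of_ne v hne, if_neg hne, sub_zero]
    split_ifs <;> simp [f]
  have h3 : AS.mulVec (fun q : S => f q) = fun q : S => g q := by
    ext q
    rw [← h2 q q.2, ← Finset.sum_coe_sort S fun q' => B q q' * f q']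
    exact Finset.sum_congr rfl fun q' _ => congrArg (· * f q') (hBS q q')
  have h4 : (fun q : S => f q) = AS⁻¹.mulVec fun q : S => g q := by
    rw [← h3, Matrix.mulVec_mulVec, Matrix.nonsing_inv_mul _ hSE, Matrix.one_mulVec]
  have h5 := congrFun h4 ⟨z, hz⟩
  simp only [f] at h5
  rw [h5, ← Finset.sum_coe_sort S fun q => boxGreen v S E z q *
      ∑ q' ∈ (Λ \ S).filter (fun q' => norm1 (q - q') = 1), boxGreen v Λ E q' w]
  refine Finset.sum_congr rfl fun q _ => ?_
  simp only [boxGreen, dif_pos (⟨hz, q.2⟩ : z ∈ S ∧ (q : Site d) ∈ S), g]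
  rfl

/-- Only points of the inner boundary of S have neighbours in Λ \ S. Counting all of S is wasteful,
but for cubes it costs only a power of the radius. -/
theorem abs_boxGreen_le (v : Site d → ℝ) {S Λ : Finset (Site d)} (hS : S ⊆ Λ) {E : ℝ}
    (hSE : IsUnit (boxMatrix v S - E • (1 : Matrix S S ℝ)).det)
    (hΛE : IsUnit (boxMatrix v Λ - E • (1 : Matrix Λ Λ ℝ)).det) {z w : Site d} (hz : z ∈ S)
    (hw : w ∈ Λ) (hwS : w ∉ S) {b M : ℝ} (hb0 : 0 ≤ b) (hM0 : 0 ≤ M)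
    (hb : ∀ q ∈ innerBoundary S, |boxGreen v S E z q| ≤ b)
    (hM : ∀ q ∈ S, ∀ q' ∈ Λ, q' ∉ S → norm1 (q - q') = 1 → |boxGreen v Λ E q' w| ≤ M) :
    |boxGreen v Λ E z w| ≤ S.card * (2 * d) * (b * M) := by
  classical
  rw [boxGreen_eq_sum v hS hSE hΛE hz hw hwS]
  refine (Finset.abs_sum_le_sum_abs _ _).trans ?_
  rw [mul_assoc, ← nsmul_eq_mul]
  refine Finset.sum_le_card_nsmul _ _ _ fun q hq => ?_
  rw [abs_mul]
  rcases Finset.eq_empty_or_nonempty ((Λ \ S).filter (fun q' => norm1 (q - q') = 1)) with h0 | ⟨q', hq'⟩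
  · rw [h0, Finset.sum_empty, abs_zero, mul_zero]
    positivity
  have hbd : q ∈ innerBoundary S := by
    obtain ⟨h1, h2⟩ := Finset.mem_filter.1 hq'
    exact mem_innerBoundary_of_neighbor hq (Finset.mem_sdiff.1 h1).2 h2
  have hsum : |∑ q' ∈ (Λ \ S).filter (fun q' => norm1 (q - q') = 1), boxGreen v Λ E q' w| ≤
      2 * d * M := by
    refine (Finset.abs_sum_le_sum_abs _ _).trans ((Finset.sum_le_card_nsmul _ _ M
      fun q' hq' => ?_).trans ?_)
    · obtain ⟨h1, h2⟩ := Finset.mem_filter.1 hq'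
      exact hM q hq q' (Finset.mem_sdiff.1 h1).1 (Finset.mem_sdiff.1 h1).2 h2
    · rw [nsmul_eq_mul]
      gcongr
      have : ((Λ \ S).filter (fun q' => norm1 (q - q') = 1)).card ≤ 2 * d := by
        rw [← card_neighbors q]
        exact Finset.card_le_card fun j hj => mem_neighbors.2 (Finset.mem_filter.1 hj).2
      exact_mod_cast this
  calc _ ≤ b * (2 * d * M) := mul_le_mul (hb q hbd) hsum (abs_nonneg _) hb0
    _ = _ := by ring

/-- An antitone family of bounds on `{0, …, N}` which improves by a factor `γ` over every step of
length `s` from a radius outside of `B`. -/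
theorem bound_iterate {P : ℕ → ℝ → Prop} {B : Finset ℕ} {N s : ℕ} {γ M₀ : ℝ}
    (hs : 0 < s) (hP : ∀ r r' M, r ≤ r' → P r' M → P r M) (h0 : P N M₀)
    (hstep : ∀ r k, r ∉ B → r + s ≤ N → P (r + s) (γ ^ k * M₀) → P r (γ ^ (k + 1) * M₀)) (n : ℕ)
    (hn : n * s + B.card ≤ N) : P 0 (γ ^ n * M₀) := by
  -- The invariant is a budget of radii between r and N: s for each of the n gains and one for each
  -- bad radius from r on. A bad radius is skipped without gain.
  suffices H : ∀ t r n : ℕ, N - r ≤ t → r ≤ N →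
      r + n * s + (B.filter fun q => r ≤ q).card ≤ N → P r (γ ^ n * M₀) by
    refine H N 0 n (by omega) (by omega) ?_
    have := Finset.card_filter_le B fun q => 0 ≤ q
    omega
  intro t
  induction t with
  | zero =>
    intro r n ht hr hle
    have hrN : r = N := by omega
    have hns : n * s = 0 := by omega
    obtain rfl : n = 0 := (Nat.mul_eq_zero.1 hns).resolve_right hs.ne'
    rw [hrN]
    simpa using h0
  | succ t ih =>
    intro r n ht hr hle
    rcases Nat.eq_zero_or_pos n with rfl | hn0
    · simpa using hP r N M₀ hr h0
    obtain ⟨n, rfl⟩ : ∃ k, n = k + 1 := ⟨n - 1, by omega⟩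
    by_cases hrB : r ∈ B
    · have hcard : (B.filter fun q => r + 1 ≤ q).card < (B.filter fun q => r ≤ q).card :=
        Finset.card_lt_card ⟨fun q hq => by
          rw [Finset.mem_filter] at hq ⊢; exact ⟨hq.1, by omega⟩, fun hcon => by
          have := (Finset.mem_filter.1 (hcon (Finset.mem_filter.2 ⟨hrB, le_rfl⟩))).2
          omega⟩
      exact hP r (r + 1) _ (by omega) (ih (r + 1) (n + 1) (by omega) (by omega) (by omega))
    · have hle' : r + (n * s + s) + (B.filter fun q => r ≤ q).card ≤ N := by
        rw [← Nat.succ_mul]; exact hle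
      have hsub : (B.filter fun q => r + s ≤ q).card ≤ (B.filter fun q => r ≤ q).card :=
        Finset.card_le_card fun q hq => by
          rw [Finset.mem_filter] at hq ⊢; exact ⟨hq.1, by omega⟩
      exact hstep r n hrB (by omega) (ih (r + s) n (by omega) (by omega) (by omega))

end AlloyMSA

/-! ### Decay of the Green's function in a large cube. -/

namespace AlloyMSA

variable {d : ℕ} {μ : Measure ℝ}

theorem card_filter_abs_sub_le (N : ℕ) (t : ℝ) {l : ℝ} (hl : 0 ≤ l) :
    (((Finset.range N).filter fun r : ℕ => |(r : ℝ) - t| ≤ l).card : ℝ) ≤ 2 * l + 1 := by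
  have hsub : (((Finset.range N).filter fun r : ℕ => |(r : ℝ) - t| ≤ l).image
      (fun r : ℕ => (r : ℤ))) ⊆ Finset.Icc ⌈t - l⌉ ⌊t + l⌋ := by
    intro k hk
    obtain ⟨r, hr, rfl⟩ := Finset.mem_image.1 hk
    have := abs_le.1 (Finset.mem_filter.1 hr).2
    rw [Finset.mem_Icc, Int.ceil_le, Int.le_floor]
    push_cast
    constructor <;> linarith
  have h1 := Finset.card_le_card hsub
  rw [Finset.card_image_of_injective _ Nat.cast_injective, Int.card_Icc] at h1
  have h2 := Int.floor_le (t + l)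
  have h3 := Int.le_ceil (t - l)
  have h4 : ((⌊t + l⌋ + 1 - ⌈t - l⌉ : ℤ) : ℝ) ≤ 2 * l + 1 := by
    push_cast
    linarith
  have h5 : (((⌊t + l⌋ + 1 - ⌈t - l⌉).toNat : ℕ) : ℝ) ≤ 2 * l + 1 := by
    rcases le_total 0 (⌊t + l⌋ + 1 - ⌈t - l⌉) with h | h
    · rw [← Int.toNat_of_nonneg h] at h4
      exact_mod_cast h4
    · rw [Int.toNat_of_nonpos h]
      simp
      linarith
  exact le_trans (by exact_mod_cast h1) h5

theorem IsRegular.isUnit_det {u : Site d → ℝ} {l : ℝ} {x : Site d} {m E : ℝ} {ω : Config d μ}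
    (h : IsRegular u l x m E ω) :
    IsUnit (boxMatrix (potential u ω) (cube l x) -
      E • (1 : Matrix (cube l x) (cube l x) ℝ)).det :=
  isUnit_det_of_notMem_spectrum h.1

theorem abs_boxGreen_le_of_not_resonant {v : Site d → ℝ} {S : Finset (Site d)} {E ε : ℝ}
    (hε : 0 < ε) (h : ¬ Resonant (boxMatrix v S) E ε) (x y : Site d) :
    |boxGreen v S E x y| ≤ 1 / ε := by
  rw [boxGreen]
  split_ifs with hxy
  · exact abs_resolvent_le_of_not_resonant hε h _ _
  · rw [abs_zero]; positivity

theorem card_cube_le_of_le {r L : ℝ} (hr : 0 ≤ r) (hrL : r ≤ L) (hL : 1 ≤ L) (x : Site d) :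
    ((cube r x).card : ℝ) ≤ (3 * L) ^ d :=
  (card_cube_le hr x).trans (by gcongr; linarith)

/-- One step of the iteration: a non-resonant cube surrounded by regular cubes of radius `l`. -/
theorem abs_green_step {u : Site d → ℝ} {ω : Config d μ} {E ε l m L : ℝ} (hε : 0 < ε) (hl : 1 ≤ l)
    {x w : Site d} {r s : ℕ} (hs : l + 2 ≤ s) (hrs : ((r + s : ℕ) : ℝ) ≤ L)
    (hr : ¬ Resonant (boxHamiltonian u ω (cube r x)) E ε)
    (hΛ : ¬ Resonant (boxHamiltonian u ω (cube L x)) E ε)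
    (hreg : ∀ z ∈ cube (r + 1) x, z ∉ cube r x → IsRegular u l z m E ω)
    (hw : w ∈ innerBoundary (cube L x)) {M : ℝ} (hM0 : 0 ≤ M)
    (hM : ∀ q ∈ cube ((r + s : ℕ) : ℝ) x, |green u ω (cube L x) E q w| ≤ M) :
    ∀ z ∈ cube r x, |green u ω (cube L x) E z w| ≤
      (2 * d * (3 * L) ^ d) ^ 2 * Real.exp (-(m * l)) / ε * M := by
  simp only [green_eq, boxHamiltonian_eq] at *
  have hwΛ : w ∈ cube L x := (Finset.mem_filter.1 hw).1
  have hw1 := notMem_cube_of_mem_innerBoundary hw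
  have hΛu := isUnit_det_of_not_resonant hΛ
  push_cast at hrs
  have hr0 : (0 : ℝ) ≤ r := Nat.cast_nonneg r
  have hL1 : 1 ≤ L := by linarith
  set M₁ : ℝ := (3 * L) ^ d * (2 * d) * (Real.exp (-(m * l)) * M)
  -- Points just outside radius r are centres of regular cubes: the identity gains exp(-ml) and ends
  -- within l + 1 of z, hence inside radius r + l + 2 ≤ r + s. The non-resonant cube of radius r
  -- then carries the bound inward at the cost 1/ε.
  have hshell : ∀ z ∈ cube ((r : ℝ) + 1) x, z ∉ cube r x →
      |boxGreen (potential u ω) (cube L x) E z w| ≤ M₁ := by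
    intro z hz hzr
    have hz' := hreg z hz hzr
    have hsub : cube l z ⊆ cube (L - 1) x := fun k hk =>
      cube_subset_cube (by linarith) x (mem_cube_trans hk hz)
    refine (abs_boxGreen_le (potential u ω) (hsub.trans (cube_subset_cube (by linarith) x))
      hz'.isUnit_det hΛu (mem_cube.2 fun i => by simp; linarith) hwΛ (fun h => hw1 (hsub h))
      (Real.exp_pos _).le hM0 (fun q hq => hz'.2 q hq) fun q hq q' hq' _ hqq' => ?_).trans ?_
    · refine hM q' (cube_subset_cube ?_ x (mem_cube_trans (mem_cube_add_one hq hqq') hz))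
      push_cast
      linarith
    · simp only [M₁]
      gcongr
      exact card_cube_le_of_le (by linarith) (by linarith) hL1 z
  intro z hz
  have hM₁ : 0 ≤ M₁ := by positivity
  have hrL : cube (r : ℝ) x ⊆ cube (L - 1) x := cube_subset_cube (by linarith) x
  refine (abs_boxGreen_le (potential u ω) (hrL.trans (cube_subset_cube (by linarith) x))
    (isUnit_det_of_not_resonant hr) hΛu hz hwΛ (fun h => hw1 (hrL h)) (by positivity) hM₁
    (fun q _ => abs_boxGreen_le_of_not_resonant hε hr z q) fun q hq q' _ hq'r hqq' =>
      hshell q' (mem_cube_add_one hq hqq') hq'r).trans ?_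
  calc ((cube (r : ℝ) x).card : ℝ) * (2 * d) * (1 / ε * M₁)
      ≤ (3 * L) ^ d * (2 * d) * (1 / ε * M₁) := by
        gcongr
        exact card_cube_le_of_le hr0 (by linarith) hL1 x
    _ = _ := by
        simp only [M₁]
        ring

/-- A cube is regular if all concentric cubes are non-resonant and all cubes of the smaller radius
`l` are regular, up to those with centers near at most three points. -/
theorem isRegular_of_regular_subcubes {u : Site d → ℝ} {ω : Config d μ} {E ε l m mL L : ℝ}
    (hε : 0 < ε) (hl : 1 ≤ l) (hL : 1 ≤ L) {x : Site d}
    (hr : ∀ r : ℕ, r ≤ ⌊L⌋₊ → ¬ Resonant (boxHamiltonian u ω (cube r x)) E ε)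
    {Z : Finset (Site d)} (hZ : Z.card ≤ 3)
    (hreg : ∀ z ∈ cube L x, (∀ c ∈ Z, 8 * l < ‖z - c‖) → IsRegular u l z m E ω) (n : ℕ)
    (hn : (n : ℝ) * (l + 3) + 58 * l ≤ L)
    (hbound : ((2 * d * (3 * L) ^ d) ^ 2 * Real.exp (-(m * l)) / ε) ^ n * (1 / ε) ≤
      Real.exp (-(mL * L))) : IsRegular u L x mL E ω := by
  classical
  have hΛ : ¬ Resonant (boxHamiltonian u ω (cube L x)) E ε := by
    have h := hr ⌊L⌋₊ le_rfl
    have key : ∀ S T : Finset (Site d), S = T → ¬ Resonant (boxHamiltonian u ω S) E ε →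
        ¬ Resonant (boxHamiltonian u ω T) E ε := by
      rintro S _ rfl h
      exact h
    exact key _ _ (cube_floor (by linarith) x) h
  refine ⟨notMem_spectrum_of_isUnit_det (isUnit_det_of_not_resonant hΛ), fun w hw => ?_⟩
  refine le_trans ?_ hbound
  set γ := (2 * d * (3 * L) ^ d) ^ 2 * Real.exp (-(m * l)) / ε
  have hγ : 0 ≤ γ := by positivity
  let bad : ℕ → Prop := fun r =>
    ∃ z ∈ cube ((r : ℝ) + 1) x, z ∉ cube (r : ℝ) x ∧ ¬ IsRegular u l z m E ω
  let B : Finset ℕ := (Finset.range ⌊L⌋₊).filter bad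
  have hfl := Nat.floor_le (show 0 ≤ L by linarith)
  have hfl' := Nat.lt_floor_add_one L
  -- A bad radius is within 8l + 1 of the distance from x to one of three centres, which leaves at
  -- most 3(16l + 3) ≤ 57l of them because l ≥ 1.
  have hB : (B.card : ℝ) ≤ 57 * l := by
    have hsub : B ⊆ Z.biUnion fun c => (Finset.range ⌊L⌋₊).filter fun r : ℕ =>
        |(r : ℝ) - ‖c - x‖| ≤ 8 * l + 1 := by
      intro r hr
      obtain ⟨hrL, z, hz, hzr, hbad⟩ := Finset.mem_filter.1 hr
      have hr0 : (0 : ℝ) ≤ r := Nat.cast_nonneg r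
      rw [mem_cube_iff_norm (by linarith)] at hz
      rw [mem_cube_iff_norm hr0, not_le] at hzr
      have hrL' : (r : ℝ) + 1 ≤ L := by
        have : ((r + 1 : ℕ) : ℝ) ≤ ⌊L⌋₊ := by exact_mod_cast Finset.mem_range.1 hrL
        push_cast at this
        linarith
      have hex : ∃ c ∈ Z, ‖z - c‖ ≤ 8 * l := by
        by_contra! hcon
        exact hbad (hreg z ((mem_cube_iff_norm (by linarith)).2 (hz.trans hrL')) hcon)
      obtain ⟨c, hc, hzc⟩ := hex
      refine Finset.mem_biUnion.2 ⟨c, hc, Finset.mem_filter.2 ⟨hrL, ?_⟩⟩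
      have h1 := abs_norm_sub_norm_le (z - x) (c - x)
      rw [sub_sub_sub_cancel_right] at h1
      have h2 := abs_le.1 (h1.trans hzc)
      rw [abs_le]
      constructor <;> linarith [h2.1, h2.2]
    have h1 : (B.card : ℝ) ≤ ∑ c ∈ Z, (2 * (8 * l + 1) + 1) := by
      refine le_trans (Nat.cast_le.2 ((Finset.card_le_card hsub).trans Finset.card_biUnion_le)) ?_
      push_cast
      exact Finset.sum_le_sum fun c _ => card_filter_abs_sub_le _ _ (by linarith)
    rw [Finset.sum_const, nsmul_eq_mul] at h1
    have h2 : (Z.card : ℝ) ≤ 3 := by exact_mod_cast hZ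
    nlinarith
  let s := ⌈l⌉₊ + 2
  have hs : l + 2 ≤ (s : ℕ) := by
    simp only [s]
    push_cast
    linarith [Nat.le_ceil l]
  have hs' : (s : ℝ) ≤ l + 3 := by
    simp only [s]
    push_cast
    linarith [Nat.ceil_lt_add_one (show 0 ≤ l by linarith)]
  -- 58l covers the 57l bad radii and the loss of less than 1 ≤ l in `⌊L⌋₊`.
  have hcount : n * s + B.card ≤ ⌊L⌋₊ := by
    have h1 : ((n * s + B.card : ℕ) : ℝ) ≤ ⌊L⌋₊ := by
      push_cast
      have : (n : ℝ) * s ≤ n * (l + 3) := by gcongr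
      linarith
    exact_mod_cast h1
  have hiter := bound_iterate (B := B) (N := ⌊L⌋₊) (s := s) (γ := γ) (M₀ := 1 / ε)
    (P := fun r M => ∀ q ∈ cube (r : ℝ) x, |green u ω (cube L x) E q w| ≤ M)
    (by simp [s]) (fun r r' M hrr' h q hq => h q (cube_subset_cube (by exact_mod_cast hrr') x hq))
    (fun q _ => abs_boxGreen_le_of_not_resonant hε hΛ q w)
    (fun r k hrB hrs hP => by
      have hrs' : ((r + s : ℕ) : ℝ) ≤ L := le_trans (by exact_mod_cast hrs) hfl
      have h1 := abs_green_step hε hl hs hrs' (hr r (by omega)) hΛ (m := m) (fun z hz hzr => by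
        by_contra hcon
        refine hrB (Finset.mem_filter.2 ⟨Finset.mem_range.2 ?_, z, hz, hzr, hcon⟩)
        have : 0 < s := by simp [s]
        omega) hw (by positivity) hP
      intro q hq
      refine (h1 q hq).trans (le_of_eq ?_)
      simp only [γ]
      ring) n hcount
  exact hiter x (mem_cube.2 fun i => by simp)

end AlloyMSA

/-! ### Measurability and independence of the bad events -/

namespace AlloyMSA

theorem isSigmaCompact_inter {X : Type*} [TopologicalSpace X] [T2Space X] {s t : Set X}
    (hs : IsSigmaCompact s) (ht : IsSigmaCompact t) : IsSigmaCompact (s ∩ t) := by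
  obtain ⟨K, hK, rfl⟩ := hs
  obtain ⟨K', hK', rfl⟩ := ht
  rw [iUnion_inter_iUnion]
  exact isSigmaCompact_iUnion _ fun i => isSigmaCompact_iUnion_of_isCompact _ fun j =>
    (hK i).inter (hK' j)

theorem isSigmaCompact_preimage {X Y : Type*} [TopologicalSpace X] [SigmaCompactSpace X]
    [TopologicalSpace Y] [T2Space Y] {f : X → Y} (hf : Continuous f) {s : Set Y}
    (hs : IsSigmaCompact s) : IsSigmaCompact (f ⁻¹' s) := by
  obtain ⟨K, hK, rfl⟩ := hs
  rw [preimage_iUnion]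
  exact isSigmaCompact_iUnion _ fun n =>
    isSigmaCompact_of_isClosed ((hK n).isClosed.preimage hf)

theorem isSigmaCompact_of_isOpen {X : Type*} [PseudoEMetricSpace X] [SigmaCompactSpace X]
    {s : Set X} (h : IsOpen s) : IsSigmaCompact s := by
  obtain ⟨F, hF, -, rfl, -⟩ := h.exists_iUnion_isClosed
  exact isSigmaCompact_iUnion _ fun n => isSigmaCompact_of_isClosed (hF n)

theorem isSigmaCompact_of_ordConnected {I : Set ℝ} (hI : I.OrdConnected) : IsSigmaCompact I := by
  have h := hI.isPreconnected.mem_intervals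
  simp only [mem_insert_iff, mem_singleton_iff] at h
  rcases h with h | h | h | h | h | h | h | h | h | h <;> rw [h]
  · exact isSigmaCompact_of_isClosed isClosed_Icc
  · rw [← Ici_inter_Iio]
    exact isSigmaCompact_inter (isSigmaCompact_of_isClosed isClosed_Ici)
      (isSigmaCompact_of_isOpen isOpen_Iio)
  · rw [← Ioi_inter_Iic]
    exact isSigmaCompact_inter (isSigmaCompact_of_isOpen isOpen_Ioi)
      (isSigmaCompact_of_isClosed isClosed_Iic)
  · exact isSigmaCompact_of_isOpen isOpen_Ioo
  · exact isSigmaCompact_of_isClosed isClosed_Ici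
  · exact isSigmaCompact_of_isOpen isOpen_Ioi
  · exact isSigmaCompact_of_isClosed isClosed_Iic
  · exact isSigmaCompact_of_isOpen isOpen_Iio
  · exact isSigmaCompact_univ
  · exact isSigmaCompact_empty

theorem isSigmaCompact_lt {X : Type*} [TopologicalSpace X] [SigmaCompactSpace X] {f g : X → ℝ}
    (hf : Continuous f) (hg : Continuous g) : IsSigmaCompact {p | f p < g p} := by
  have h : {p | f p < g p} = ⋃ n : ℕ, {p | f p + 1 / ((n : ℝ) + 1) ≤ g p} := by
    ext p
    simp only [mem_ofPred_eq, mem_iUnion]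
    constructor
    · intro hp
      obtain ⟨n, hn⟩ := exists_nat_one_div_lt (sub_pos.2 hp)
      exact ⟨n, by linarith⟩
    · rintro ⟨n, hn⟩
      have : (0 : ℝ) < 1 / ((n : ℝ) + 1) := Nat.one_div_pos_of_nat
      linarith
  rw [h]
  exact isSigmaCompact_iUnion _ fun n =>
    isSigmaCompact_of_isClosed (isClosed_le (hf.add continuous_const) hg)

variable {d : ℕ} {μ : Measure ℝ}

theorem compactSpace_support (hμ : Bornology.IsBounded μ.support) : CompactSpace μ.support :=
  isCompact_iff_compactSpace.1
    (Metric.isCompact_of_isClosed_isBounded Measure.isClosed_support hμ)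

theorem continuous_potential {u : Site d → ℝ} (hu : ExpDecay u)
    (hμ : Bornology.IsBounded μ.support) (x : Site d) :
    Continuous fun ω : Config d μ => potential u ω x := by
  obtain ⟨R, hR0, hR⟩ := exists_bound_support hμ
  have h1 : Summable fun k => |u (x - k)| := (Equiv.subLeft x).summable_iff.2 hu.summable
  refine continuous_tsum (fun k => by fun_prop) (h1.mul_left R) fun k ω => ?_
  rw [norm_mul]
  exact mul_le_mul_of_nonneg_right (hR (ω k)) (norm_nonneg _)

theorem continuous_boxHamiltonian {u : Site d → ℝ} (hu : ExpDecay u)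
    (hμ : Bornology.IsBounded μ.support) (S : Finset (Site d)) :
    Continuous fun ω : Config d μ => boxHamiltonian u ω S := by
  refine continuous_matrix fun i j => ?_
  have := continuous_potential hu hμ (i : Site d)
  simp only [boxHamiltonian_eq, boxMatrix, Matrix.of_apply, latticeEntry]
  fun_prop

/-- Cramer's rule clears the denominator: determinant and adjugate are continuous in the energy and
the configuration, also at singular matrices, where the inverse is not. -/
theorem not_isRegular_iff {u : Site d → ℝ} {l : ℝ} {z : Site d} {m E : ℝ}
    {ω : Config d μ} (hz : z ∈ cube l z) :
    ¬ IsRegular u l z m E ω ↔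
      (boxHamiltonian u ω (cube l z) - E • (1 : Matrix (cube l z) (cube l z) ℝ)).det = 0 ∨
      ∃ w : cube l z, (w : Site d) ∈ innerBoundary (cube l z) ∧ Real.exp (-(m * l)) *
        |(boxHamiltonian u ω (cube l z) - E • (1 : Matrix (cube l z) (cube l z) ℝ)).det| <
        |(boxHamiltonian u ω (cube l z) -
          E • (1 : Matrix (cube l z) (cube l z) ℝ)).adjugate ⟨z, hz⟩ w| := by
  set A := boxHamiltonian u ω (cube l z) - E • (1 : Matrix (cube l z) (cube l z) ℝ) with hA
  by_cases h0 : A.det = 0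
  · simp only [h0, true_or, iff_true]
    intro h
    exact not_isUnit_zero (h0 ▸ isUnit_det_of_notMem_spectrum h.1)
  · simp only [h0, false_or]
    have hspec : E ∉ spectrum ℝ (boxHamiltonian u ω (cube l z)) :=
      notMem_spectrum_of_isUnit_det (isUnit_iff_ne_zero.2 h0)
    have hgreen : ∀ w : cube l z, |green u ω (cube l z) E z w| =
        |A.adjugate ⟨z, hz⟩ w| / |A.det| := fun w => by
      rw [green, dif_pos ⟨hz, w.2⟩, ← hA, Matrix.inv_def, Matrix.smul_apply, Ring.inverse_eq_inv,
        smul_eq_mul, abs_mul, abs_inv]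
      ring
    have hd : 0 < |A.det| := abs_pos.2 h0
    simp only [IsRegular, hspec, not_false_eq_true, true_and, not_forall, not_le]
    constructor
    · rintro ⟨w, hw, h⟩
      have hw' : w ∈ cube l z := (Finset.mem_filter.1 hw).1
      refine ⟨⟨w, hw'⟩, hw, ?_⟩
      rw [hgreen ⟨w, hw'⟩, lt_div_iff₀ hd] at h
      exact h
    · rintro ⟨w, hw, h⟩
      refine ⟨w, hw, ?_⟩
      rw [hgreen w, lt_div_iff₀ hd]
      exact h

theorem isSigmaCompact_not_isRegular {u : Site d → ℝ} (hu : ExpDecay u)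
    (hμ : Bornology.IsBounded μ.support) {l : ℝ} (hl : 0 ≤ l) (z : Site d) (m : ℝ) :
    IsSigmaCompact {p : ℝ × Config d μ | ¬ IsRegular u l z m p.1 p.2} := by
  have := compactSpace_support hμ
  have hz : z ∈ cube l z := mem_cube.2 fun i => by simpa using hl
  let A : ℝ × Config d μ → Matrix (cube l z) (cube l z) ℝ := fun p =>
    boxHamiltonian u p.2 (cube l z) - p.1 • (1 : Matrix (cube l z) (cube l z) ℝ)
  have hA : Continuous A := by
    have := (continuous_boxHamiltonian hu hμ (cube l z)).comp
      (continuous_snd (X := ℝ) (Y := Config d μ))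
    exact this.sub (continuous_fst.smul continuous_const)
  have hdet : Continuous fun p => (A p).det := hA.matrix_det
  have hadj : ∀ w, Continuous fun p => (A p).adjugate ⟨z, hz⟩ w := fun w =>
    hA.matrix_adjugate.matrix_elem _ _
  have heq : {p : ℝ × Config d μ | ¬ IsRegular u l z m p.1 p.2} =
      {p | (A p).det = 0} ∪ ⋃ w : {w : cube l z // (w : Site d) ∈ innerBoundary (cube l z)},
        {p | Real.exp (-(m * l)) * |(A p).det| < |(A p).adjugate ⟨z, hz⟩ w|} := by
    ext p
    simp only [mem_ofPred_eq, mem_union, mem_iUnion, Subtype.exists]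
    rw [not_isRegular_iff hz]
    refine or_congr Iff.rfl ?_
    constructor
    · rintro ⟨w, hw, h⟩
      exact ⟨w, w.2, hw, h⟩
    · rintro ⟨w, hw', hw, h⟩
      exact ⟨⟨w, hw'⟩, hw, h⟩
  rw [heq, union_eq_iUnion]
  refine isSigmaCompact_iUnion _ fun b => ?_
  cases b
  · exact isSigmaCompact_iUnion _ fun w =>
      isSigmaCompact_lt (continuous_const.mul hdet.abs) (hadj _).abs
  · exact isSigmaCompact_of_isClosed (isClosed_eq hdet continuous_const)

/-- Failure of uniform regularity asserts the existence of some ω', so it is a projection along a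
second copy of the compact space Ω. -/
theorem isSigmaCompact_not_isUnifRegular {u : Site d → ℝ} (hu : ExpDecay u)
    (hμ : Bornology.IsBounded μ.support) {l : ℝ} (hl : 0 ≤ l) (z : Site d) (m : ℝ) :
    IsSigmaCompact {p : ℝ × Config d μ | ¬ IsUnifRegular u l z m p.1 p.2} := by
  have := compactSpace_support hμ
  let N : Set (ℝ × Config d μ) := {p | ¬ IsRegular u l z m p.1 p.2}
  let F : Set (ℝ × Config d μ × Config d μ) := {p | ∀ k ∈ cube (4 * l) z, p.2.2 k = p.2.1 k}
  have hF : IsClosed F := by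
    have : F = ⋂ k ∈ cube (4 * l) z, {p | p.2.2 k = p.2.1 k} := by
      ext p
      simp [F]
    rw [this]
    exact isClosed_biInter fun k _ => isClosed_eq (by fun_prop) (by fun_prop)
  have h1 : IsSigmaCompact ((fun p : ℝ × Config d μ × Config d μ => (p.1, p.2.2)) ⁻¹' N) :=
    isSigmaCompact_preimage (by fun_prop) (isSigmaCompact_not_isRegular hu hμ hl z m)
  have h2 := (isSigmaCompact_inter h1 (isSigmaCompact_of_isClosed hF)).image
    (f := fun p : ℝ × Config d μ × Config d μ => (p.1, p.2.1)) (by fun_prop)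
  convert h2 using 1
  ext ⟨E, ω⟩
  simp only [IsUnifRegular, not_forall, mem_ofPred_eq, mem_image, mem_inter_iff, mem_preimage,
    Prod.exists, N, F, Prod.mk.injEq]
  constructor
  · rintro ⟨ω', h, h'⟩
    exact ⟨E, ω, ω', ⟨h', h⟩, rfl, rfl⟩
  · rintro ⟨E', ω₁, ω', ⟨h', h⟩, rfl, rfl⟩
    exact ⟨ω', h, h'⟩

theorem measurableSet_badEvent {u : Site d → ℝ} (hu : ExpDecay u)
    (hμ : Bornology.IsBounded μ.support) {l : ℝ} (hl : 0 ≤ l) (z₁ z₂ : Site d) (m : ℝ)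
    {I : Set ℝ} (hI : I.OrdConnected) : MeasurableSet (badEvent μ u l z₁ z₂ m I) := by
  have := compactSpace_support hμ
  have h1 : IsSigmaCompact ((Prod.fst : ℝ × Config d μ → ℝ) ⁻¹' I) :=
    isSigmaCompact_preimage continuous_fst (isSigmaCompact_of_ordConnected hI)
  have h2 := (isSigmaCompact_inter
    (isSigmaCompact_inter h1 (isSigmaCompact_not_isUnifRegular hu hμ hl z₁ m))
    (isSigmaCompact_not_isUnifRegular hu hμ hl z₂ m)).image continuous_snd
  refine measurableSet_of_isSigmaCompact ?_
  convert h2 using 1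
  ext ω
  simp only [badEvent, mem_ofPred_eq, mem_image, mem_inter_iff, mem_preimage, Prod.exists]
  constructor
  · rintro ⟨E, hE, h, h'⟩
    exact ⟨E, ω, ⟨⟨hE, h⟩, h'⟩, rfl⟩
  · rintro ⟨E, ω', ⟨⟨hE, h⟩, h'⟩, rfl⟩
    exact ⟨E, hE, h, h'⟩

/-- Membership in `A` depends only on the couplings at the sites in `T`. -/
def DependsOnSites (A : Set (Config d μ)) (T : Finset (Site d)) : Prop :=
  ∀ ω ω' : Config d μ, (∀ k ∈ T, ω k = ω' k) → ω ∈ A → ω' ∈ A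

/-- Quantifying over all modifications off the cubes of radius 4l makes the event local although u
has unbounded range. -/
theorem dependsOnSites_badEvent [DecidableEq (Site d)] (u : Site d → ℝ) (l : ℝ) (z₁ z₂ : Site d)
    (m : ℝ) (I : Set ℝ) :
    DependsOnSites (badEvent μ u l z₁ z₂ m I) (cube (4 * l) z₁ ∪ cube (4 * l) z₂) := by
  rintro ω ω' h ⟨E, hE, h1, h2⟩
  refine ⟨E, hE, fun hr => h1 fun ω'' h'' => hr ω'' fun k hk => ?_,
    fun hr => h2 fun ω'' h'' => hr ω'' fun k hk => ?_⟩
  · rw [h'' k hk, h k (Finset.mem_union_left _ hk)]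
  · rw [h'' k hk, h k (Finset.mem_union_right _ hk)]

open Classical in
theorem DependsOnSites.eq_preimage {A : Set (Config d μ)} {T : Finset (Site d)}
    (h : DependsOnSites A T) (hA : MeasurableSet A) (ω₀ : Config d μ) :
    ∃ A' : Set (T → μ.support), MeasurableSet A' ∧ A = T.restrict ⁻¹' A' := by
  let e : (T → μ.support) → Config d μ := fun η k => if hk : k ∈ T then η ⟨k, hk⟩ else ω₀ k
  have he : Measurable e := by
    refine measurable_pi_lambda _ fun k => ?_
    by_cases hk : k ∈ T
    · simp only [e, hk, dite_true]
      fun_prop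
    · simp only [e, hk, dite_false]
      fun_prop
  refine ⟨e ⁻¹' A, he hA, ?_⟩
  ext ω
  have hag : ∀ k ∈ T, ω k = e (T.restrict ω) k := fun k hk => by simp [e, hk]
  exact ⟨fun hω => h ω _ hag hω, fun hω => h _ ω (fun k hk => (hag k hk).symm) hω⟩

theorem prob_inter_eq_mul [IsProbabilityMeasure μ] {A A' : Set (Config d μ)}
    {T T' : Finset (Site d)} (hT : Disjoint T T') (h : DependsOnSites A T)
    (h' : DependsOnSites A' T') (hA : MeasurableSet A) (hA' : MeasurableSet A') :
    (prob d μ).real (A ∩ A') = (prob d μ).real A * (prob d μ).real A' := by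
  obtain ⟨ω₀⟩ : Nonempty (Config d μ) := (prob d μ).nonempty_of_neZero
  obtain ⟨B, hB, rfl⟩ := h.eq_preimage hA ω₀
  obtain ⟨B', hB', rfl⟩ := h'.eq_preimage hA' ω₀
  have hind : ProbabilityTheory.iIndepFun (fun (k : Site d) (ω : Config d μ) => ω k) (prob d μ) :=
    ProbabilityTheory.iIndepFun_infinitePi (X := fun _ : Site d => (id : μ.support → μ.support))
      fun _ => measurable_id
  have h2 := (hind.indepFun_finset T T' hT fun k => measurable_pi_apply k).measure_inter_preimage_eq_mul
    B B' hB hB'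
  simp only [Measure.real]
  rw [← ENNReal.toReal_mul]
  exact congrArg ENNReal.toReal h2

theorem GEstimate.measure_badEvent_le [IsProbabilityMeasure μ] {u : Site d → ℝ} (hu : ExpDecay u)
    (hμ : Bornology.IsBounded μ.support) {I : Set ℝ} (hI : I.OrdConnected) {l m ξ : ℝ}
    (hl : 0 ≤ l) (hG : GEstimate μ u I l m ξ) {z₁ z₂ : Site d} (hz : 8 * l < ‖z₁ - z₂‖) :
    (prob d μ).real (badEvent μ u l z₁ z₂ m I) ≤ l ^ (-(2 * ξ)) := by
  have h := hG z₁ z₂ hz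
  rw [probReal_compl_eq_one_sub (measurableSet_badEvent hu hμ hl z₁ z₂ m hI)] at h
  linarith

theorem disjoint_cube_of_lt {l : ℝ} (hl : 0 ≤ l) {x y : Site d} (h : 8 * l < ‖x - y‖) :
    Disjoint (cube (4 * l) x) (cube (4 * l) y) := by
  rw [Finset.disjoint_left]
  intro k hx hy
  rw [mem_cube_iff_norm (by linarith)] at hx hy
  have h1 := norm_sub_le (k - y) (k - x)
  rw [sub_sub_sub_cancel_left] at h1
  linarith

/-- Four cubes of radius `l` with distant centers in the cube of radius `L` about `x` fail to be
uniformly regular for a common energy. -/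
def fourBadEvent (μ : Measure ℝ) (u : Site d → ℝ) (l L : ℝ) (x : Site d) (m : ℝ) (I : Set ℝ) :
    Set (Config d μ) :=
  {ω | ∃ E ∈ I, ∃ z : Fin 4 → Site d, (∀ i, z i ∈ cube L x) ∧
    (∀ i j, i ≠ j → 8 * l < ‖z i - z j‖) ∧ ∀ i, ¬ IsUnifRegular u l (z i) m E ω}

/-- This is a union bound over quadruples of centres. The four cubes of radius 4l are disjoint, so
two pairs give independent events, and the squared probability pays for the number of quadruples. -/
theorem measure_fourBadEvent_le [IsProbabilityMeasure μ] {u : Site d → ℝ} (hu : ExpDecay u)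
    (hμ : Bornology.IsBounded μ.support) {I : Set ℝ} (hI : I.OrdConnected) {l L m ξ : ℝ}
    (hl : 0 ≤ l) (hG : GEstimate μ u I l m ξ) (x : Site d) :
    (prob d μ).real (fourBadEvent μ u l L x m I) ≤
      ((cube L x).card : ℝ) ^ 4 * (l ^ (-(2 * ξ)) * l ^ (-(2 * ξ))) := by
  classical
  let far : (Fin 4 → Site d) → Prop := fun z => ∀ i j, i ≠ j → 8 * l < ‖z i - z j‖
  let Q : Finset (Fin 4 → Site d) := (Fintype.piFinset fun _ => cube L x).filter far
  have hsub : fourBadEvent μ u l L x m I ⊆ ⋃ z ∈ Q,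
      badEvent μ u l (z 0) (z 1) m I ∩ badEvent μ u l (z 2) (z 3) m I := by
    rintro ω ⟨E, hE, z, hz, hfar, hbad⟩
    refine mem_biUnion (x := z) (Finset.mem_coe.2 (Finset.mem_filter.2
      ⟨Fintype.mem_piFinset.2 hz, hfar⟩)) ⟨⟨E, hE, hbad 0, hbad 1⟩, E, hE, hbad 2, hbad 3⟩
  have hl0 : 0 ≤ l ^ (-(2 * ξ)) := Real.rpow_nonneg hl _
  have hone : ∀ z ∈ Q, (prob d μ).real
      (badEvent μ u l (z 0) (z 1) m I ∩ badEvent μ u l (z 2) (z 3) m I) ≤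
      l ^ (-(2 * ξ)) * l ^ (-(2 * ξ)) := by
    intro z hz
    have hfar : far z := (Finset.mem_filter.1 hz).2
    have hd : ∀ i j, i ≠ j → Disjoint (cube (4 * l) (z i)) (cube (4 * l) (z j)) := fun i j hij =>
      disjoint_cube_of_lt hl (hfar i j hij)
    rw [prob_inter_eq_mul (T := cube (4 * l) (z 0) ∪ cube (4 * l) (z 1))
      (T' := cube (4 * l) (z 2) ∪ cube (4 * l) (z 3))
      (by
        rw [Finset.disjoint_union_left, Finset.disjoint_union_right, Finset.disjoint_union_right]
        exact ⟨⟨hd 0 2 (by decide), hd 0 3 (by decide)⟩, hd 1 2 (by decide), hd 1 3 (by decide)⟩)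
      (dependsOnSites_badEvent u l _ _ m I) (dependsOnSites_badEvent u l _ _ m I)
      (measurableSet_badEvent hu hμ hl _ _ m hI) (measurableSet_badEvent hu hμ hl _ _ m hI)]
    exact mul_le_mul (hG.measure_badEvent_le hu hμ hI hl (hfar 0 1 (by decide)))
      (hG.measure_badEvent_le hu hμ hI hl (hfar 2 3 (by decide))) measureReal_nonneg hl0
  calc (prob d μ).real (fourBadEvent μ u l L x m I)
      ≤ (prob d μ).real (⋃ z ∈ Q,
        badEvent μ u l (z 0) (z 1) m I ∩ badEvent μ u l (z 2) (z 3) m I) :=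
        measureReal_mono hsub (measure_ne_top _ _)
    _ ≤ ∑ z ∈ Q, (prob d μ).real
        (badEvent μ u l (z 0) (z 1) m I ∩ badEvent μ u l (z 2) (z 3) m I) :=
        measureReal_biUnion_finset_le _ _
    _ ≤ Q.card • (l ^ (-(2 * ξ)) * l ^ (-(2 * ξ))) := Finset.sum_le_card_nsmul _ _ _ hone
    _ ≤ _ := by
        rw [nsmul_eq_mul]
        gcongr
        have : Q.card ≤ (cube L x).card ^ 4 := by
          refine (Finset.card_filter_le _ _).trans (le_of_eq ?_)
          simp
        exact_mod_cast this

/-- A set without four points at mutual distance greater than `R` is covered by three balls of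
radius `R`. -/
theorem exists_cover_of_no_four_far {X : Type*} [SeminormedAddCommGroup X] {S : Set X} {R : ℝ}
    (h : ¬ ∃ z : Fin 4 → X, (∀ i, z i ∈ S) ∧ ∀ i j, i ≠ j → R < ‖z i - z j‖) :
    ∃ C : Finset X, C.card ≤ 3 ∧ ∀ z ∈ S, ∃ c ∈ C, ‖z - c‖ ≤ R := by
  classical
  by_contra! hcon
  -- Greedy choice: as long as at most three balls fail to cover S, there is a further point of S
  -- far from all earlier ones.
  obtain ⟨a, ha, -⟩ := hcon ∅ (by simp)
  obtain ⟨b, hb, hb'⟩ := hcon {a} (by simp)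
  obtain ⟨c, hc, hc'⟩ := hcon {a, b} (Finset.card_le_two.trans (by norm_num))
  obtain ⟨e, he, he'⟩ := hcon {a, b, c} Finset.card_le_three
  have hab := hb' a (by simp)
  have hac := hc' a (by simp)
  have hbc := hc' b (by simp)
  have hae := he' a (by simp)
  have hbe := he' b (by simp)
  have hce := he' c (by simp)
  refine h ⟨![a, b, c, e], fun i => ?_, fun i j hij => ?_⟩
  · fin_cases i <;> simpa
  · fin_cases i <;> fin_cases j <;> simp at hij ⊢ <;>
      first | assumption | (rw [norm_sub_rev]; assumption)

end AlloyMSA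

/-! ### The induction step -/

namespace AlloyMSA

variable {d : ℕ} {μ : Measure ℝ}

/-- The exceptional centres are determined by ω alone, so the same three balls serve every ω'.
Uniform regularity at z passes to ω' because the cube of radius 4l about z lies in the one of radius
4L about x. -/
theorem isUnifRegular_of_notMem_fourBadEvent {u : Site d → ℝ} {ω : Config d μ} {I : Set ℝ}
    {E ε l m mL L : ℝ} (hE : E ∈ I) (hε : 0 < ε) (hl : 1 ≤ l) {x : Site d}
    (hω : ω ∉ fourBadEvent μ u l L x m I)
    (hr : ∀ ω' : Config d μ, (∀ k ∈ cube (4 * L) x, ω' k = ω k) → ∀ r : ℕ, r ≤ ⌊L⌋₊ →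
      ¬ Resonant (boxHamiltonian u ω' (cube r x)) E ε) (n : ℕ)
    (hn : (n : ℝ) * (l + 3) + 58 * l ≤ L)
    (hbound : ((2 * d * (3 * L) ^ d) ^ 2 * Real.exp (-(m * l)) / ε) ^ n * (1 / ε) ≤
      Real.exp (-(mL * L))) : IsUnifRegular u L x mL E ω := by
  have hn0 : 0 ≤ (n : ℝ) * (l + 3) := by positivity
  obtain ⟨Z, hZ, hcov⟩ := exists_cover_of_no_four_far
    (S := {z | z ∈ cube L x ∧ ¬ IsUnifRegular u l z m E ω}) (R := 8 * l) fun ⟨z, hz, hfar⟩ =>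
      hω ⟨E, hE, z, fun i => (hz i).1, hfar, fun i => (hz i).2⟩
  intro ω' hω'
  refine isRegular_of_regular_subcubes hε hl (by linarith) (hr ω' hω') hZ
    (fun z hz hfar => ?_) n hn hbound
  have hreg : IsUnifRegular u l z m E ω := by
    by_contra hcon
    obtain ⟨c, hc, hzc⟩ := hcov z ⟨hz, hcon⟩
    exact absurd (hfar c hc) (not_lt.2 hzc)
  exact hreg ω' fun k hk => hω' k (cube_subset_cube (by linarith) x (mem_cube_trans hk hz))

/-- Some concentric subcubes of two cubes of radius `L` have a common resonance, for some
modifications of the configuration outside of the cubes of radius `4L`. -/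
def commonResonanceEvent (μ : Measure ℝ) (u : Site d → ℝ) (L ε : ℝ) (x y : Site d) (r r' : ℕ) :
    Set (Config d μ) :=
  {ω | ∃ E, (∃ ω' : Config d μ, (∀ k ∈ cube (4 * L) x, ω' k = ω k) ∧
      Resonant (boxHamiltonian u ω' (cube r x)) E ε) ∧
    (∃ ω' : Config d μ, (∀ k ∈ cube (4 * L) y, ω' k = ω k) ∧
      Resonant (boxHamiltonian u ω' (cube r' y)) E ε)}

theorem badEvent_subset {u : Site d → ℝ} {I : Set ℝ} {ε l m mL L : ℝ} (hε : 0 < ε) (hl : 1 ≤ l)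
    (x y : Site d) (n : ℕ) (hn : (n : ℝ) * (l + 3) + 58 * l ≤ L)
    (hbound : ((2 * d * (3 * L) ^ d) ^ 2 * Real.exp (-(m * l)) / ε) ^ n * (1 / ε) ≤
      Real.exp (-(mL * L))) :
    badEvent μ u L x y mL I ⊆ (fourBadEvent μ u l L x m I ∪ fourBadEvent μ u l L y m I) ∪
      ⋃ p ∈ Finset.range (⌊L⌋₊ + 1) ×ˢ Finset.range (⌊L⌋₊ + 1),
        commonResonanceEvent μ u L ε x y p.1 p.2 := by
  rintro ω ⟨E, hE, hx, hy⟩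
  by_cases hfx : ω ∈ fourBadEvent μ u l L x m I
  · exact Or.inl (Or.inl hfx)
  by_cases hfy : ω ∈ fourBadEvent μ u l L y m I
  · exact Or.inl (Or.inr hfy)
  have key : ∀ z, ω ∉ fourBadEvent μ u l L z m I → ¬ IsUnifRegular u L z mL E ω →
      ∃ r ∈ Finset.range (⌊L⌋₊ + 1), ∃ ω' : Config d μ, (∀ k ∈ cube (4 * L) z, ω' k = ω k) ∧
        Resonant (boxHamiltonian u ω' (cube r z)) E ε := by
    intro z hz hreg
    by_contra! hcon
    exact hreg (isUnifRegular_of_notMem_fourBadEvent hE hε hl hz (fun ω' hω' r hr =>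
      hcon r (Finset.mem_range.2 (by omega)) ω' hω') n hn hbound)
  obtain ⟨r, hr, h⟩ := key x hfx hx
  obtain ⟨r', hr', h'⟩ := key y hfy hy
  exact Or.inr (mem_biUnion (x := (r, r'))
    (Finset.mem_coe.2 (Finset.mem_product.2 ⟨hr, hr'⟩)) ⟨E, h, h'⟩)

theorem measure_badEvent_le [IsProbabilityMeasure μ] {u : Site d → ℝ} (hu : ExpDecay u)
    (hμ : Bornology.IsBounded μ.support) {I : Set ℝ} (hI : I.OrdConnected) {ε l m mL L ξ W : ℝ}
    (hε : 0 < ε) (hl : 1 ≤ l) {x y : Site d} (n : ℕ) (hn : (n : ℝ) * (l + 3) + 58 * l ≤ L)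
    (hbound : ((2 * d * (3 * L) ^ d) ^ 2 * Real.exp (-(m * l)) / ε) ^ n * (1 / ε) ≤
      Real.exp (-(mL * L))) (hG : GEstimate μ u I l m ξ) (hW0 : 0 ≤ W)
    (hW : ∀ r r' : ℕ, r ≤ ⌊L⌋₊ → r' ≤ ⌊L⌋₊ →
      (prob d μ).real (commonResonanceEvent μ u L ε x y r r') ≤ W) :
    (prob d μ).real (badEvent μ u L x y mL I) ≤
      2 * ((3 * L) ^ d) ^ 4 * (l ^ (-(2 * ξ)) * l ^ (-(2 * ξ))) + (2 * L) ^ 2 * W := by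
  have hn0 : 0 ≤ (n : ℝ) * (l + 3) := by positivity
  have hL1 : 1 ≤ L := by linarith
  have hl0 : 0 ≤ l ^ (-(2 * ξ)) := Real.rpow_nonneg (by linarith) _
  have hfour : ∀ z : Site d, (prob d μ).real (fourBadEvent μ u l L z m I) ≤
      ((3 * L) ^ d) ^ 4 * (l ^ (-(2 * ξ)) * l ^ (-(2 * ξ))) := fun z => by
    refine (measure_fourBadEvent_le hu hμ hI (by linarith) hG z).trans ?_
    gcongr
    exact card_cube_le_of_le (by linarith) le_rfl hL1 z
  have hcommon : (prob d μ).real (⋃ p ∈ Finset.range (⌊L⌋₊ + 1) ×ˢ Finset.range (⌊L⌋₊ + 1),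
      commonResonanceEvent μ u L ε x y p.1 p.2) ≤ (2 * L) ^ 2 * W := by
    refine (measureReal_biUnion_finset_le _ _).trans
      ((Finset.sum_le_card_nsmul _ _ W fun p hp => ?_).trans ?_)
    · obtain ⟨h1, h2⟩ := Finset.mem_product.1 hp
      rw [Finset.mem_range] at h1 h2
      exact hW _ _ (by omega) (by omega)
    · rw [nsmul_eq_mul, Finset.card_product, Finset.card_range, sq]
      push_cast
      have := Nat.floor_le (show 0 ≤ L by linarith)
      gcongr <;> linarith
  calc _ ≤ _ := measureReal_mono (badEvent_subset hε hl x y n hn hbound) (measure_ne_top _ _)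
    _ ≤ _ := measureReal_union_le _ _
    _ ≤ ((prob d μ).real (fourBadEvent μ u l L x m I) +
        (prob d μ).real (fourBadEvent μ u l L y m I)) + (2 * L) ^ 2 * W :=
        add_le_add (measureReal_union_le _ _) hcommon
    _ ≤ _ := by linarith [hfour x, hfour y]

/-- n is the largest count that the radius allows, so n l ≥ L - 62l - 3L/l (58l for bad radii, the
rest from rounding and from l + 3). The prefactors and powers of 1/ε cost at most exp(2sn + s) ≤
exp(3sL/l). Each loss is at most Lh/2; the first is multiplied by m. -/
theorem exists_step_count {l L m h s Q : ℝ} (hl : 1 ≤ l) (hm : 0 ≤ m) (hs : 0 ≤ s)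
    (hQ : Q ^ 2 ≤ Real.exp s) (hlL : 58 * l ≤ L) (h1 : 62 * l + 3 * (L / l) ≤ L * h / 2)
    (h2 : 3 * s * (L / l) ≤ L * h / 2) :
    ∃ n : ℕ, (n : ℝ) * (l + 3) + 58 * l ≤ L ∧
      (Q ^ 2 * Real.exp (-(m * l)) / Real.exp (-s)) ^ n * (1 / Real.exp (-s)) ≤
        Real.exp (-((m * (1 - h / 2) - h / 2) * L)) := by
  set n := ⌊(L - 58 * l) / (l + 3)⌋₊
  have hl3 : 0 < l + 3 := by linarith
  have hn1 : (n : ℝ) * (l + 3) ≤ L - 58 * l := by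
    rw [← le_div_iff₀ hl3]
    exact Nat.floor_le (div_nonneg (by linarith) hl3.le)
  have hn2 : L - 58 * l < (n + 1) * (l + 3) := by
    rw [← div_lt_iff₀ hl3]
    exact Nat.lt_floor_add_one _
  have hn3 : (n : ℝ) ≤ L / l := by
    rw [le_div_iff₀ (by linarith)]
    have : (0 : ℝ) ≤ n := Nat.cast_nonneg n
    nlinarith
  have hLl : 1 ≤ L / l := by
    rw [le_div_iff₀ (by linarith)]
    linarith
  refine ⟨n, by linarith, ?_⟩
  have hbase : Q ^ 2 * Real.exp (-(m * l)) / Real.exp (-s) ≤ Real.exp (2 * s - m * l) := by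
    rw [div_le_iff₀ (Real.exp_pos _)]
    calc Q ^ 2 * Real.exp (-(m * l)) ≤ Real.exp s * Real.exp (-(m * l)) := by gcongr
      _ = _ := by
        rw [← Real.exp_add, ← Real.exp_add]
        congr 1
        ring
  calc _ ≤ Real.exp (2 * s - m * l) ^ n * (1 / Real.exp (-s)) := by gcongr
    _ = Real.exp (n * (2 * s - m * l) + s) := by
        rw [← Real.exp_nat_mul, one_div, ← Real.exp_neg, neg_neg, ← Real.exp_add]
    _ ≤ _ := by
        rw [Real.exp_le_exp]
        have h3 : 2 * s * n + s ≤ L * h / 2 := by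
          refine le_trans ?_ h2
          nlinarith
        have h4 : L * (1 - h / 2) ≤ n * l := by linarith
        nlinarith [mul_le_mul_of_nonneg_left h4 hm]

theorem eventually_mul_rpow_le_rpow (A : ℝ) {a b : ℝ} (hab : a < b) :
    ∀ᶠ l : ℝ in Filter.atTop, A * l ^ a ≤ l ^ b := by
  filter_upwards [(tendsto_rpow_atTop (sub_pos.2 hab)).eventually_ge_atTop A,
    Filter.eventually_gt_atTop 0] with l h hl
  calc A * l ^ a ≤ l ^ (b - a) * l ^ a := by gcongr
    _ = l ^ b := by rw [← Real.rpow_add hl, sub_add_cancel]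

theorem eventually_mul_rpow_le_exp (A q : ℝ) {s c : ℝ} (hs : 0 < s) (hc : 0 < c) :
    ∀ᶠ l : ℝ in Filter.atTop, A * l ^ q ≤ Real.exp (c * l ^ s) := by
  have h1 := (isLittleO_rpow_exp_pos_mul_atTop ((q + 1) / s) hc).bound one_pos
  filter_upwards [(tendsto_rpow_atTop hs).eventually h1, Filter.eventually_ge_atTop A,
    Filter.eventually_gt_atTop 0] with l h hA hl
  rw [one_mul, Real.norm_eq_abs, Real.norm_eq_abs, Real.abs_exp, ← Real.rpow_mul hl.le,
    mul_div_cancel₀ _ hs.ne', abs_of_nonneg (by positivity)] at h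
  refine le_trans ?_ h
  rw [Real.rpow_add hl, Real.rpow_one, mul_comm]
  gcongr

end AlloyMSA

/-! ### Asymptotic inequalities between the scales. -/

namespace AlloyMSA

variable {d : ℕ} {μ : Measure ℝ}

/-- The scales `l`, `l ^ κ` are eventually so far apart that the step count applies. -/
theorem eventually_scale_bounds {κ β : ℝ} (hκ : 1 < κ) (hβ : 2 - κ < β) (hβ0 : 0 < β)
    (hβ1 : β < 1) :
    ∀ᶠ l : ℝ in Filter.atTop, 58 * l ≤ l ^ κ ∧
      62 * l + 3 * (l ^ κ / l) ≤ l ^ κ * l ^ (β - 1) / 2 ∧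
      3 * l ^ (β / 2) * (l ^ κ / l) ≤ l ^ κ * l ^ (β - 1) / 2 ∧
      l ^ (β - 1) ≤ 1 / 2 ∧ 4 * (l ^ κ) ^ (β - 1) ≤ l ^ (β - 1) := by
  have e1 := eventually_mul_rpow_le_rpow 58 hκ
  -- β > 2 - κ enters here: the lost radii, of order l, must be negligible against L l^(β-1) =
  -- l^(κ+β-1).
  have e2 := eventually_mul_rpow_le_rpow 248 (show 1 < κ + (β - 1) by linarith)
  have e3 := eventually_mul_rpow_le_rpow 12 (show κ - 1 < κ + (β - 1) by linarith)
  -- The exponent β/2 of the width stays below β, so the accumulated loss l^(β/2) L/l is of lower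
  -- order than L l^(β-1).
  have e4 := eventually_mul_rpow_le_rpow 6 (show β / 2 + (κ - 1) < κ + (β - 1) by linarith)
  have e5 := eventually_mul_rpow_le_rpow 2 (show β - 1 < 0 by linarith)
  have e6 := eventually_mul_rpow_le_rpow 4 (show κ * (β - 1) < β - 1 by nlinarith)
  filter_upwards [e1, e2, e3, e4, e5, e6, Filter.eventually_gt_atTop 0]
    with l h1 h2 h3 h4 h5 h6 hl
  rw [← Real.rpow_mul hl.le, ← Real.rpow_add hl, ← Real.rpow_sub_one hl.ne', mul_assoc,
    ← Real.rpow_add hl]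
  rw [Real.rpow_one] at h1 h2
  rw [Real.rpow_zero] at h5
  refine ⟨h1, ?_, ?_, ?_, h6⟩ <;> linarith

/-- Both contributions to the probability of the bad event on scale `l ^ κ` are eventually
small enough. -/
theorem eventually_probability_bound {ξ κ β : ℝ} (D : ℝ) (d p : ℕ)
    (hξκ : κ * (ξ + 2 * d) < 2 * ξ) (hβ : 0 < β) :
    ∀ᶠ l : ℝ in Filter.atTop,
      2 * ((3 * l ^ κ) ^ d) ^ 4 * (l ^ (-(2 * ξ)) * l ^ (-(2 * ξ))) +
        (2 * l ^ κ) ^ 2 * (D * (l ^ κ) ^ p * √(Real.exp (-l ^ (β / 2)))) ≤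
      (l ^ κ) ^ (-(2 * ξ)) := by
  -- 4dκ - 4ξ < -2ξκ is exactly the upper bound on κ: the four-cube term is then of lower order than
  -- L^(-2ξ).
  have e1 := eventually_mul_rpow_le_rpow (4 * (3 ^ d) ^ 4)
    (show κ * (d * 4) + (-(2 * ξ) + -(2 * ξ)) < κ * -(2 * ξ) by nlinarith)
  have e2 := eventually_mul_rpow_le_exp (8 * D) (κ * (2 + p) + κ * (2 * ξ))
    (half_pos hβ) (half_pos one_pos)
  filter_upwards [e1, e2, Filter.eventually_gt_atTop 0] with l h1 h2 hl
  have hL : 0 < l ^ κ := Real.rpow_pos_of_pos hl κ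
  have hsq : √(Real.exp (-l ^ (β / 2))) = Real.exp (-(1 / 2 * l ^ (β / 2))) := by
    rw [← Real.exp_half]
    ring_nf
  have t1 : 2 * ((3 * l ^ κ) ^ d) ^ 4 * (l ^ (-(2 * ξ)) * l ^ (-(2 * ξ))) ≤
      (l ^ κ) ^ (-(2 * ξ)) / 2 := by
    rw [← Real.rpow_mul hl.le, mul_pow, mul_pow]
    rw [Real.rpow_add hl, Real.rpow_add hl, Real.rpow_mul hl.le, Real.rpow_mul hL.le,
      Real.rpow_natCast] at h1
    norm_cast at h1 ⊢
    push_cast at h1 ⊢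
    linarith
  have t2 : (2 * l ^ κ) ^ 2 * (D * (l ^ κ) ^ p * √(Real.exp (-l ^ (β / 2)))) ≤
      (l ^ κ) ^ (-(2 * ξ)) / 2 := by
    rw [hsq, Real.exp_neg, Real.rpow_neg hL.le]
    rw [Real.rpow_add hl, Real.rpow_mul hl.le, Real.rpow_mul hl.le, Real.rpow_add hL,
      Real.rpow_natCast, Real.rpow_two] at h2
    have hX : 0 < (l ^ κ) ^ (2 * ξ) := Real.rpow_pos_of_pos hL _
    have hY := Real.exp_pos (1 / 2 * l ^ (β / 2))
    generalize Real.exp (1 / 2 * l ^ (β / 2)) = Y at *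
    generalize (l ^ κ) ^ (2 * ξ) = X at *
    rw [← div_eq_mul_inv, ← mul_div_assoc, div_le_iff₀ hY, ← one_div, div_div, div_mul_eq_mul_div,
      le_div_iff₀ (by positivity)]
    linarith
  linarith

/-- The resonance width `exp (-l ^ (β / 2))` is eventually admissible for the Wegner estimate on
scale `l ^ κ`, and dominates the combinatorial factors. -/
theorem eventually_width_bounds {κ β : ℝ} (K L₀ : ℝ) {c : ℝ} (hc : 0 < c) (d : ℕ) (hκ : 1 < κ)
    (hβ0 : 0 < β) (hβ1 : β < 1) :
    ∀ᶠ l : ℝ in Filter.atTop, L₀ ≤ l ^ κ ∧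
      K * Real.exp (-c * l ^ κ) ≤ Real.exp (-l ^ (β / 2)) ∧
      Real.exp (-l ^ (β / 2)) ≤ 1 / 2 ∧
      (2 * d * (3 * l ^ κ) ^ d) ^ 2 ≤ Real.exp (l ^ (β / 2)) := by
  have e1 := eventually_mul_rpow_le_rpow L₀ (show 0 < κ by linarith)
  have e2 := eventually_mul_rpow_le_rpow (2 / c) (show β / 2 < κ by linarith)
  have e3 := eventually_mul_rpow_le_exp K 0 (show 0 < κ by linarith) (half_pos hc)
  have e4 := eventually_mul_rpow_le_exp 2 0 (half_pos hβ0) one_pos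
  have e5 := eventually_mul_rpow_le_exp ((2 * d * 3 ^ d) ^ 2) (κ * (d * 2)) (half_pos hβ0) one_pos
  filter_upwards [e1, e2, e3, e4, e5, Filter.eventually_gt_atTop 0] with l h1 h2 h3 h4 h5 hl
  rw [Real.rpow_zero, mul_one] at h1 h3 h4
  rw [one_mul] at h4 h5
  refine ⟨h1, ?_, ?_, ?_⟩
  · rw [div_mul_eq_mul_div, div_le_iff₀ hc] at h2
    calc K * Real.exp (-c * l ^ κ)
        ≤ Real.exp (c / 2 * l ^ κ) * Real.exp (-c * l ^ κ) := by gcongr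
      _ = Real.exp (-(c / 2 * l ^ κ)) := by rw [← Real.exp_add]; ring_nf
      _ ≤ _ := Real.exp_le_exp.2 (by linarith)
  · rw [Real.exp_neg, ← one_div]
    exact one_div_le_one_div_of_le two_pos h4
  · rw [Real.rpow_mul hl.le] at h5
    norm_cast at h5 ⊢
    rw [pow_mul] at h5
    convert h5 using 1
    push_cast
    ring

end AlloyMSA

/-! ### Choice of the new rate and conclusion. -/

open AlloyMSA in
theorem theorem6p1 (d : ℕ) (hd : 1 ≤ d)
    (u : AlloyMSA.Site d → ℝ) (hu : AlloyMSA.ExpDecay u) (hu0 : u ≠ 0)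
    (μ : Measure ℝ) [IsProbabilityMeasure μ] (hμ : Bornology.IsBounded μ.support)
    (ρ : ℝ → ℝ) (hρ : AlloyMSA.IsDensity μ ρ) (hBV : AlloyMSA.IsBV ρ)
    (ξ κ β : ℝ) (hξ : 2 * (d : ℝ) < ξ)
    (hκ : κ ∈ Set.Ioo 1 (2 * ξ / (ξ + 2 * (d : ℝ)))) (hβ : β ∈ Set.Ioo (2 - κ) 1) :
    ∃ lstar : ℝ, 1 ≤ lstar ∧
      ∀ (I : Set ℝ) (l m L : ℝ), I.OrdConnected → lstar ≤ l → l ^ (β - 1) < m → L = l ^ κ →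
        AlloyMSA.GEstimate μ u I l m ξ →
        ∃ mL : ℝ, 0 < mL ∧ mL < m ∧
          m * (1 - L ^ (-((1 - β) / κ))) - L ^ (-((1 - β) / κ)) < mL ∧
          L ^ (β - 1) < mL ∧
          AlloyMSA.GEstimate μ u I L mL ξ := by
  obtain ⟨hκ1, hκ2⟩ := hκ
  obtain ⟨hβ2, hβ1⟩ := hβ
  have hd0 : (0 : ℝ) ≤ d := d.cast_nonneg
  have hξd : 0 < ξ + 2 * (d : ℝ) := by linarith
  have hξκ : κ * (ξ + 2 * d) < 2 * ξ := (lt_div_iff₀ hξd).1 hκ2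
  have hβ0 : 0 < β := by
    have : κ < 2 := hκ2.trans_le ((div_le_iff₀ hξd).2 (by linarith))
    linarith
  obtain ⟨V, hV, hsh⟩ := exists_shiftBound hρ hBV
  obtain ⟨D, K, c, L₀, p, hD, -, hc, -, hweg⟩ := exists_uniform_wegner hu hu0 hμ hV hsh
  obtain ⟨l₀, hl₀⟩ := Filter.eventually_atTop.1
    ((eventually_scale_bounds hκ1 hβ2 hβ0 hβ1).and
      ((eventually_probability_bound D d p hξκ hβ0).and
        (eventually_width_bounds K L₀ hc d hκ1 hβ0 hβ1)))
  refine ⟨max l₀ 1, le_max_right _ _, ?_⟩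
  rintro I l m L hI hl hm rfl hG
  obtain ⟨⟨hs1, hs2, hs3, hs4, hs5⟩, hprob, hw1, hw2, hw3, hw4⟩ := hl₀ l ((le_max_left _ _).trans hl)
  have hl1 : 1 ≤ l := (le_max_right _ _).trans hl
  have hl0 : 0 < l := by linarith
  have hL0 : 0 ≤ l ^ κ := Real.rpow_nonneg hl0.le κ
  have hh0 : 0 < l ^ (β - 1) := Real.rpow_pos_of_pos hl0 _
  have hm0 : 0 < m := hh0.trans hm
  -- The allowed loss is h = l^(β-1). The new rate below loses only h/2 in each place, which makes
  -- the lower bound strict.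
  have hhL : (l ^ κ) ^ (-((1 - β) / κ)) = l ^ (β - 1) := by
    rw [← Real.rpow_mul hl0.le]
    congr 1
    field_simp
    ring
  have hLβ : 0 ≤ (l ^ κ) ^ (β - 1) := Real.rpow_nonneg hL0 _
  obtain ⟨n, hn, hbound⟩ := exists_step_count hl1 hm0.le (Real.rpow_nonneg hl0.le (β / 2)) hw4
    hs1 hs2 hs3
  rw [hhL]
  -- m > h and h ≤ 1/2 give a rate above h/2 - h²/2 ≥ h/4, which in turn is at least L^(β-1).
  have hquarter : l ^ (β - 1) / 4 < m * (1 - l ^ (β - 1) / 2) - l ^ (β - 1) / 2 := by nlinarith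
  refine ⟨m * (1 - l ^ (β - 1) / 2) - l ^ (β - 1) / 2, by linarith, by nlinarith, by nlinarith,
    by linarith, fun x y hxy => ?_⟩
  rw [probReal_compl_eq_one_sub (measurableSet_badEvent hu hμ hL0 x y _ hI)]
  have hcube : ∀ (z : Site d) (r : ℕ), r ≤ ⌊l ^ κ⌋₊ → cube (r : ℝ) z ⊆ cube (l ^ κ) z :=
    fun z r hr => cube_subset_cube ((Nat.cast_le.2 hr).trans (Nat.floor_le hL0)) z
  have hbad := measure_badEvent_le hu hμ hI (Real.exp_pos _) hl1 (x := x) (y := y) n hn hbound hG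
    (W := D * (l ^ κ) ^ p * √(Real.exp (-l ^ (β / 2)))) (by positivity)
    fun r r' hr hr' => hweg _ hw1 _ hw2 hw3 x y (disjoint_cube_of_lt hL0 hxy) _ (hcube x r hr) _
      (hcube y r' hr')
  linarith
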